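/- Let $n\ge 3$, $m\ge 0$ and $m+2\le s\le 2m+3$ be integers. Let $M$ be an $n\times(n+m)$ matrix of linear forms on $\mathbb{C}^{s+1}$, and write $M_v$ for its value at $v$. For general $M$ (that is, for all $M$ in a nonempty Zariski open subset of the space of such matrices, depending only on $n,m,s$) the following holds. Let $S=\{[v]\in\mathbb{P}^s : \operatorname{rank} M_v\le n-1\}$, regarded as a projective variety. For each $[v]\in S$ the kernel of $M_v^t$ is one-dimensional, spanned by a vector $\alpha_v$, and $[v]\mapsto[\alpha_v]$ is a morphism $\psi\colon S\to\mathbb{P}^{n-1}$. For $\alpha\in\mathbb{C}^n$ let $A_\alpha$ be the $(n+m)\times(s+1)$ matrix with $A_\alpha v=M_v^t\alpha$ for all $v$; then $\alpha\mapsto A_\alpha$ is injective and defines a linear embedding $f\colon\mathbb{P}^{n-1}\to\mathbb{P}=\mathbb{P}(\mathrm{Mat}_{n+m,s+1}(\mathbb{C}))$. Let $N_k\subset\mathbb{P}$ be the set of matrices of rank at most $k$ (so $N_k=\emptyset$ for $k\le 0$). (i) Assume $s=n+m$. Then (1) $\psi$ is surjective, and its fibre over each point of some nonempty Zariski open subset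 of $\mathbb{P}^{n-1}$ is a single point; (2) $f\circ\psi$ has one-dimensional fibres; the fibre over $y\in\mathbb{P}$ has dimension at least $1$ if and only if $y\in\operatorname{Im}(f)\cap N_{s-1}$, and dimension exactly $1$ if and only if $y\in\operatorname{Im}(f)\cap(N_{s-1}\setminus N_{s-2})$. (ii) Assume $s<n+m$. Then (1) $\psi$ is a closed immersion if and only if $n>2s-2m-3$, in which case the image of $f\circ\psi$ is $\operatorname{Im}(f)\cap N_s$; (2) $f\circ\psi$ has a one-dimensional fibre if and only if $n\le 2s-2m-3$; the fibre over $y\in\mathbb{P}$ has dimension at least $1$ if and only if $y\in\operatorname{Im}(f)\cap N_{s-1}$, and dimension exactly $1$ if and only if $y\in\operatorname{Im}(f)\cap(N_{s-1}\setminus N_{s-2})$; (3) $f\circ\psi$ has a two-dimensional fibre if and only if $n\le\frac12(3s-3m-7)$; the fibre over $y\in\mathbb{P}$ has dimension at least $2$ if and only if $y\in\operatorname{Im}(f)\cap N_{s-2}$, and dimension exactly $2$ if and only if $y\in\operatorname{Im}(f)\cap(N_{s-2}\setminus N_{s-3})$. -/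

import Mathlib

open scoped LinearAlgebra.Projectivization

noncomputable section

namespace DegLocus

/-! ### Projective space, its Zariski topology, varieties and morphisms -/

/-- The Zariski topology on the projective space with homogeneous coordinates indexed by `ι`: the
sets `{F ≠ 0}`, for `F` a homogeneous polynomial, generate (and are in fact a basis of) it. -/
instance zariskiTopology {ι : Type} : TopologicalSpace (ℙ ℂ (ι → ℂ)) :=
  TopologicalSpace.generateFrom
    {U | ∃ (F : MvPolynomial ι ℂ) (d : ℕ), F.IsHomogeneous d ∧
      U = {x | MvPolynomial.eval x.rep F ≠ 0}}

/-- The value at `x` of the degree zero rational function `F / G`. If `F` and `G` are homogeneous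
of the same degree then this does not depend on the representative of `x`, see
`ratio_mk`. -/
def ratio {ι : Type} (F G : MvPolynomial ι ℂ) (x : ℙ ℂ (ι → ℂ)) : ℂ :=
  MvPolynomial.eval x.rep F / MvPolynomial.eval x.rep G

theorem eval_smul_of_isHomogeneous {ι : Type} {F : MvPolynomial ι ℂ} {d : ℕ}
    (hF : F.IsHomogeneous d) (c : ℂ) (v : ι → ℂ) :
    MvPolynomial.eval (c • v) F = c ^ d * MvPolynomial.eval v F := by
  rw [MvPolynomial.eval_eq, MvPolynomial.eval_eq, Finset.mul_sum]
  refine Finset.sum_congr rfl fun e he => ?_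
  have hd : ∑ i ∈ e.support, e i = d := by
    have h := hF (MvPolynomial.mem_support_iff.mp he)
    simpa [Finsupp.weight_apply, Finsupp.sum] using h
  simp only [Pi.smul_apply, smul_eq_mul, mul_pow, Finset.prod_mul_distrib,
    Finset.prod_pow_eq_pow_sum, hd]
  ring

theorem ratio_mk {ι : Type} {F G : MvPolynomial ι ℂ} {d : ℕ} (hF : F.IsHomogeneous d)
    (hG : G.IsHomogeneous d) (v : ι → ℂ) (hv : v ≠ 0) :
    ratio F G (Projectivization.mk ℂ v hv) = MvPolynomial.eval v F / MvPolynomial.eval v G := by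
  obtain ⟨a, ha⟩ := Projectivization.exists_smul_eq_mk_rep ℂ v hv
  have ha0 : (a : ℂ) ^ d ≠ 0 := pow_ne_zero _ a.ne_zero
  rw [ratio, ← ha, Units.smul_def, eval_smul_of_isHomogeneous hF, eval_smul_of_isHomogeneous hG,
    mul_div_mul_left _ _ ha0]

section Varieties

variable {ι κ : Type}

/-- Let `X` be a subset of a projective space and `φ` a map from `X` to a projective space.
Near `x`, the function `h` on `X` is the pullback along `φ` of a function which is regular at
`φ x`, i.e. of a quotient `F / G` of homogeneous polynomials of the same degree with
`G (φ x) ≠ 0`. Only the germ of `h` at `x` matters. -/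
def IsPullbackGerm {X : Set (ℙ ℂ (ι → ℂ))} (φ : X → ℙ ℂ (κ → ℂ)) (h : X → ℂ) (x : X) : Prop :=
  ∃ (d : ℕ) (F G : MvPolynomial κ ℂ), F.IsHomogeneous d ∧ G.IsHomogeneous d ∧
    MvPolynomial.eval (φ x).rep G ≠ 0 ∧ ∀ᶠ y in nhds x, h y = ratio F G (φ y)

/-- The germ of `h` at `x` belongs to the local ring of the variety `X` at `x`: near `x`, the
function `h` is a quotient of homogeneous polynomials of the same degree, with denominator not
vanishing at `x`. -/
def IsRegularAt {X : Set (ℙ ℂ (ι → ℂ))} (h : X → ℂ) (x : X) : Prop :=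
  IsPullbackGerm (fun y : X => (y : ℙ ℂ (ι → ℂ))) h x

/-- A morphism from the variety `X` to a projective space: a continuous map which pulls back
regular functions to regular functions. -/
structure IsMorphism (X : Set (ℙ ℂ (ι → ℂ))) (φ : X → ℙ ℂ (κ → ℂ)) : Prop where
  continuous : Continuous φ
  regular_of_pullback : ∀ (x : X) (h : X → ℂ), IsPullbackGerm φ h x → IsRegularAt h x

/-- A closed immersion of the variety `X` in a projective space: a morphism which is a
homeomorphism onto a closed subset and which is surjective on stalks, i.e. each regular germ on
`X` at `x` is the pullback of a regular germ at `φ x`. -/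
structure IsClosedImmersion (X : Set (ℙ ℂ (ι → ℂ))) (φ : X → ℙ ℂ (κ → ℂ)) : Prop
    extends IsMorphism X φ where
  isClosedEmbedding : Topology.IsClosedEmbedding φ
  surjective_on_stalks : ∀ (x : X) (h : X → ℂ), IsRegularAt h x → IsPullbackGerm φ h x

end Varieties

/-- The property `Q` holds for a general point of the affine space `ℂ ^ σ`: it holds on a
nonempty Zariski open subset, which may be taken of the form `{P ≠ 0}`. -/
def ForGeneral {σ : Type} (Q : (σ → ℂ) → Prop) : Prop :=
  ∃ P : MvPolynomial σ ℂ, P ≠ 0 ∧ ∀ c : σ → ℂ, MvPolynomial.eval c P ≠ 0 → Q c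

/-! ### The degeneracy locus and its maps -/

/-- An `n × (n + m)` matrix of linear forms in `s + 1` variables, given by its coefficients: the
entry in row `i` and column `j` is the linear form `∑ k, M (i, j, k) * v k`. -/
abbrev LinMatrix (n m s : ℕ) : Type := Fin n × Fin (n + m) × Fin (s + 1) → ℂ

section Loci

variable {n m s : ℕ}

/-- The evaluation `M_v` of the matrix of linear forms `M` at the vector `v`. -/
def evalAt (M : LinMatrix n m s) (v : Fin (s + 1) → ℂ) : Matrix (Fin n) (Fin (n + m)) ℂ :=
  Matrix.of fun i j => ∑ k, M (i, j, k) * v k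

/-- The degeneracy locus `S ⊆ ℙ^s`, where `M` has rank at most `n - 1`. -/
def locus (M : LinMatrix n m s) : Set (ℙ ℂ (Fin (s + 1) → ℂ)) :=
  {x | (evalAt M x.rep).rank < n}

theorem exists_kernel (M : LinMatrix n m s) (x : locus M) :
    ∃ α : ℙ ℂ (Fin n → ℂ), (evalAt M x.1.rep).transpose.mulVec α.rep = 0 := by
  have hx : (evalAt M x.1.rep).transpose.rank < n := by
    rw [Matrix.rank_transpose]; exact x.2
  have hr := (evalAt M x.1.rep).transpose.mulVecLin.finrank_range_add_finrank_ker
  rw [Module.finrank_fin_fun] at hr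
  have hpos : 0 < Module.finrank ℂ (LinearMap.ker (evalAt M x.1.rep).transpose.mulVecLin) := by
    unfold Matrix.rank at hx
    omega
  have : Nontrivial (LinearMap.ker (evalAt M x.1.rep).transpose.mulVecLin) :=
    Module.finrank_pos_iff.mp hpos
  obtain ⟨a, ha⟩ := exists_ne (0 : LinearMap.ker (evalAt M x.1.rep).transpose.mulVecLin)
  have ha' : (a : Fin n → ℂ) ≠ 0 := fun h => ha (Subtype.ext h)
  refine ⟨Projectivization.mk ℂ (a : Fin n → ℂ) ha', ?_⟩
  obtain ⟨c, hc⟩ := Projectivization.exists_smul_eq_mk_rep ℂ (a : Fin n → ℂ) ha'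
  have h0 : (evalAt M x.1.rep).transpose.mulVec (a : Fin n → ℂ) = 0 := a.2
  rw [← hc, Units.smul_def, Matrix.mulVec_smul, h0, smul_zero]

/-- The map `ψ : S → ℙ^(n-1)` sending `[v]` to the kernel `[α]` of the transpose of `M_v`. This
kernel is one-dimensional at every point of `S` if `M` is general. -/
def psi (M : LinMatrix n m s) (x : locus M) : ℙ ℂ (Fin n → ℂ) :=
  (exists_kernel M x).choose

/-- The linear map sending `α` to the `(n + m) × (s + 1)` matrix `A_α` with
`A_α v = (M_v)ᵀ α` for all `v`, see `coeffMatrix_mulVec`. -/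
def coeffMatrix (M : LinMatrix n m s) :
    (Fin n → ℂ) →ₗ[ℂ] Matrix (Fin (n + m)) (Fin (s + 1)) ℂ where
  toFun α := Matrix.of fun j k => ∑ i, M (i, j, k) * α i
  map_add' α β := by
    ext j k
    simp [mul_add, Finset.sum_add_distrib]
  map_smul' c α := by
    ext j k
    simp [Finset.mul_sum, mul_left_comm]

theorem coeffMatrix_mulVec (M : LinMatrix n m s) (α : Fin n → ℂ) (v : Fin (s + 1) → ℂ) :
    (coeffMatrix M α).mulVec v = (evalAt M v).transpose.mulVec α := by
  ext j
  simp only [coeffMatrix, evalAt, Matrix.mulVec, dotProduct, LinearMap.coe_mk, AddHom.coe_mk,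
    Matrix.of_apply, Matrix.transpose_apply, Finset.sum_mul]
  rw [Finset.sum_comm]
  exact Finset.sum_congr rfl fun i _ => Finset.sum_congr rfl fun k _ => by ring

/-- The linear embedding `f : ℙ^(n-1) → ℙ(Mat)`, `[α] ↦ [A_α]`, which is defined as soon as
`α ↦ A_α` is injective. -/
def embed (M : LinMatrix n m s) (hf : Function.Injective (coeffMatrix M)) :
    ℙ ℂ (Fin n → ℂ) → ℙ ℂ (Matrix (Fin (n + m)) (Fin (s + 1)) ℂ) :=
  Projectivization.map (coeffMatrix M) hf

/-- The composition `f ∘ ψ`. -/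
def fpsi (M : LinMatrix n m s) (hf : Function.Injective (coeffMatrix M)) :
    locus M → ℙ ℂ (Matrix (Fin (n + m)) (Fin (s + 1)) ℂ) :=
  embed M hf ∘ psi M

/-- The dimension of the fibre of `f ∘ ψ` over `y`, that is, its Krull dimension in the Zariski
topology (`⊥` if the fibre is empty). -/
def fibreDim (M : LinMatrix n m s) (hf : Function.Injective (coeffMatrix M))
    (y : ℙ ℂ (Matrix (Fin (n + m)) (Fin (s + 1)) ℂ)) : WithBot ℕ∞ :=
  topologicalKrullDim (fpsi M hf ⁻¹' {y})

end Loci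

/-- The rank stratum `N_k` of matrices of rank at most `k` in the projective space of
`p × q` matrices. (In particular it is empty for `k = 0`.) -/
def rankStratum (p q k : ℕ) : Set (ℙ ℂ (Matrix (Fin p) (Fin q) ℂ)) :=
  {y | y.rep.rank ≤ k}

end DegLocus

end

noncomputable section

namespace DegLocus

/-! ### Ranks and minors -/

section Minors

variable {F : Type*} [Field F] {J K : Type*} [Fintype J] [Fintype K]

/-! The coefficients of `M` form a tensor, and `M_v^t α = A_α v`. Hence `ψ [v] = [α]` means that `v`
lies in `ker A_α`, provided that every `M_v` with `v ≠ 0` has rank at least `n - 1`. The fibre of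
`ψ` over `[α]` is then the projective space of `ker A_α`, of dimension `s - rank A_α`
(`fibreDim_embed`), and every claim about fibres becomes a claim about the ranks that occur among
the `A_α`.

The `p × q` matrices of rank at most `k` have codimension `(p - k)(q - k)`. So for a general tensor
some `α ≠ 0` has `rank A_α ≤ k` exactly when `(p - k)(q - k) < n`. That no such `α` exists otherwise
is a parameter count (`forGeneral_lt_rank_contract`). That one exists in the remaining case holds
for every tensor, and is the projective dimension theorem for determinantal varieties
(`exists_rank_le_of_lt_finrank`), proved here with a valuation ring of the function field of the
generic matrix of rank at most `k`. With `p = n + m` and `q = s + 1`, the ranks `s - 1` and `s - 2`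
give `2(n + m - s + 1) < n` and `3(n + m - s + 2) < n`, which are the two numerical criteria. The
same count for `M_v` compares `s + 1` with `2(m + 2)`; this is where `s ≤ 2m + 3` enters.

Kernels of matrices of corank one are given locally by minors
(`isLocallyPolynomial_of_mulVec_eq_zero`). So `ψ` is a morphism, and if all `A_α` have rank at least
`s`, its inverse `[α] ↦ ker A_α` is also locally polynomial, which makes `ψ` a closed immersion. If
some `A_α` has smaller rank, `ψ` contracts a line. -/

theorem exists_linearIndependent_rows (A : Matrix J K F) {k : ℕ} (hk : k ≤ A.rank) :
    ∃ f : Fin k → J, Function.Injective f ∧ LinearIndependent F (fun i => A.row (f i)) := by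
  obtain ⟨κ, a, ha, hspan, hli⟩ := exists_linearIndependent' F A.row
  have : Fintype κ := Fintype.ofInjective a ha
  have hcard : k ≤ Fintype.card κ := by
    rw [← finrank_span_eq_card hli, hspan, ← Matrix.rank_eq_finrank_span_row]
    exact hk
  obtain ⟨e⟩ : Nonempty (Fin k ↪ κ) := by
    apply Function.Embedding.nonempty_of_card_le
    simpa using hcard
  exact ⟨a ∘ e, ha.comp e.injective, hli.comp e e.injective⟩

theorem exists_minor_ne_zero (A : Matrix J K F) {k : ℕ} (hk : k ≤ A.rank) :
    ∃ (f : Fin k → J) (g : Fin k → K), Function.Injective f ∧ Function.Injective g ∧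
      (A.submatrix f g).det ≠ 0 := by
  obtain ⟨f, hf, hli⟩ := exists_linearIndependent_rows A hk
  have h1 : (A.submatrix f id).rank = k := by
    have := LinearIndependent.rank_matrix (M := A.submatrix f id) hli
    simpa using this
  have h2 : k ≤ (A.submatrix f id).transpose.rank := by rw [Matrix.rank_transpose, h1]
  obtain ⟨g, hg, hli'⟩ := exists_linearIndependent_rows _ h2
  refine ⟨f, g, hf, hg, ?_⟩
  have h3 : LinearIndependent F ((A.submatrix f g).transpose.row) := hli'
  rw [Matrix.linearIndependent_rows_iff_isUnit, Matrix.isUnit_iff_isUnit_det,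
    Matrix.det_transpose] at h3
  exact h3.ne_zero

omit [Fintype J] in
theorem minor_eq_zero (A : Matrix J K F) {k : ℕ} (hk : A.rank < k) (f : Fin k → J)
    (g : Fin k → K) : (A.submatrix f g).det = 0 := by
  by_contra h
  have h1 : (A.submatrix f g).rank = Fintype.card (Fin k) := Matrix.rank_of_det_ne_zero h
  have h2 : (A.submatrix f g).rank ≤ A.rank := Matrix.rank_submatrix_le A f g
  rw [Fintype.card_fin] at h1
  omega

end Minors

/-! ### General points -/

section General

variable {σ τ : Type}

theorem ForGeneral.mono {Q Q' : (σ → ℂ) → Prop} (h : ForGeneral Q) (hQ : ∀ c, Q c → Q' c) :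
    ForGeneral Q' := by
  obtain ⟨P, hP, h⟩ := h
  exact ⟨P, hP, fun c hc => hQ c (h c hc)⟩

theorem ForGeneral.and {Q Q' : (σ → ℂ) → Prop} (h : ForGeneral Q) (h' : ForGeneral Q') :
    ForGeneral fun c => Q c ∧ Q' c := by
  obtain ⟨P, hP, h⟩ := h
  obtain ⟨P', hP', h'⟩ := h'
  refine ⟨P * P', mul_ne_zero hP hP', fun c hc => ?_⟩
  rw [map_mul] at hc
  exact ⟨h c (left_ne_zero_of_mul hc), h' c (right_ne_zero_of_mul hc)⟩

theorem ForGeneral.of_forall {Q : (σ → ℂ) → Prop} (h : ∀ c, Q c) : ForGeneral Q :=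
  ⟨1, one_ne_zero, fun c _ => h c⟩

/-- The condition `p` does not involve the point, so the polynomial may be chosen after deciding
`p`. This lets numerical cases be carried inside one general choice of `M`. -/
theorem ForGeneral.imp {p : Prop} {Q : (σ → ℂ) → Prop} (h : p → ForGeneral Q) :
    ForGeneral fun c => p → Q c := by
  by_cases hp : p
  · exact (h hp).mono fun c hc _ => hc
  · exact .of_forall fun c hp' => absurd hp' hp

theorem ForGeneral.forall_finite {ι : Type*} [Finite ι] {Q : ι → (σ → ℂ) → Prop}
    (h : ∀ i, ForGeneral (Q i)) : ForGeneral fun c => ∀ i, Q i c := by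
  have := Fintype.ofFinite ι
  choose P hP h using h
  refine ⟨∏ i, P i, Finset.prod_ne_zero_iff.mpr fun i _ => hP i, fun c hc i => h i c ?_⟩
  rw [map_prod] at hc
  exact Finset.prod_ne_zero_iff.mp hc i (Finset.mem_univ i)

theorem ForGeneral.comp_equiv {Q : (σ → ℂ) → Prop} (h : ForGeneral Q) (e : σ ≃ τ) :
    ForGeneral fun c : τ → ℂ => Q (c ∘ e) := by
  obtain ⟨P, hP, h⟩ := h
  refine ⟨MvPolynomial.rename e P, ?_, fun c hc => h _ ?_⟩
  · exact (map_ne_zero_iff _ (MvPolynomial.rename_injective e e.injective)).mpr hP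
  · rwa [MvPolynomial.eval_rename] at hc

theorem eval_aeval (φ : σ → MvPolynomial τ ℂ) (P : MvPolynomial σ ℂ) (t : τ → ℂ) :
    MvPolynomial.eval t (MvPolynomial.aeval φ P) =
      MvPolynomial.eval (fun i => MvPolynomial.eval t (φ i)) P := by
  induction P using MvPolynomial.induction_on with
  | C a => simp [MvPolynomial.algebraMap_eq]
  | add p q hp hq => simp only [map_add, hp, hq]
  | mul_X p i hp => simp only [map_mul, hp, MvPolynomial.aeval_X, MvPolynomial.eval_X]

/-- A polynomial map from an affine space of smaller dimension misses a general point. -/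
theorem forGeneral_notMem_range [Fintype σ] [Fintype τ] (φ : σ → MvPolynomial τ ℂ)
    (h : Fintype.card τ < Fintype.card σ) :
    ForGeneral fun c : σ → ℂ => ∀ t : τ → ℂ, c ≠ fun i => MvPolynomial.eval t (φ i) := by
  -- More polynomials than variables satisfy a nontrivial relation, and that relation cuts out a
  -- hypersurface containing the image.
  have hni : ¬ AlgebraicIndependent ℂ φ := by
    intro hφ
    have h1 := hφ.cardinalMk_le_trdeg
    rw [MvPolynomial.trdeg_of_isDomain] at h1
    simp only [Cardinal.mk_fintype, Cardinal.lift_natCast, Nat.cast_le] at h1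
    omega
  rw [algebraicIndependent_iff] at hni
  push Not at hni
  obtain ⟨P, hP, hP0⟩ := hni
  refine ⟨P, hP0, fun c hc t ht => hc ?_⟩
  subst ht
  have h1 := congrArg (MvPolynomial.eval t) hP
  rw [map_zero] at h1
  rw [← h1, eval_aeval]

end General

/-! ### Ranks of contractions of a general tensor: the parameter count. -/

section Tensor

variable {I J K : Type} [Fintype I]

/-- The contraction of a tensor with a vector. -/
def contract (T : I × J × K → ℂ) (a : I → ℂ) : Matrix J K ℂ :=
  Matrix.of fun j k => ∑ i, T (i, j, k) * a i

theorem contract_smul (T : I × J × K → ℂ) (c : ℂ) (a : I → ℂ) :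
    contract T (c • a) = c • contract T a := by
  ext j k
  simp [contract, Finset.mul_sum, mul_left_comm]

variable [Fintype J] [Fintype K]

/-- A basis of the column space, padded to exactly `k` columns, spans the other columns. The padding
fixes the number of parameters at `k|J| + k(|K| - k)` whatever the actual rank. -/
theorem exists_columns_of_rank_le (A : Matrix J K ℂ) {k : ℕ} (hA : A.rank ≤ k)
    (hk : k ≤ Fintype.card K) :
    ∃ (t : Finset K) (C : t → K → ℂ), t.card = k ∧ ∀ j κ, A j κ = ∑ l : t, A j l * C l κ := by
  classical
  obtain ⟨f, hf, hli⟩ := exists_linearIndependent_rows A.transpose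
    (le_of_eq (Matrix.rank_transpose A).symm)
  have hspan : Submodule.span ℂ (Set.range fun i => A.transpose.row (f i)) =
      Submodule.span ℂ (Set.range A.transpose.row) := by
    apply Submodule.eq_of_le_of_finrank_eq
    · apply Submodule.span_mono
      rintro _ ⟨i, rfl⟩
      exact ⟨f i, rfl⟩
    · rw [finrank_span_eq_card hli, ← Matrix.rank_eq_finrank_span_row, Matrix.rank_transpose]
      simp
  obtain ⟨t, ht, htk⟩ := Finset.exists_superset_card_eq (s := Finset.univ.image f) (n := k)
    (by rw [Finset.card_image_of_injective _ hf]; simpa using hA) hk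
  have key : ∀ κ, ∃ c : t → ℂ, ∑ l : t, c l • A.transpose.row l = A.transpose.row κ := by
    intro κ
    have h1 : A.transpose.row κ ∈ Submodule.span ℂ (Set.range fun l : t => A.transpose.row l) := by
      have h2 : A.transpose.row κ ∈ Submodule.span ℂ (Set.range fun i => A.transpose.row (f i)) := by
        rw [hspan]
        exact Submodule.subset_span ⟨κ, rfl⟩
      refine Submodule.span_mono ?_ h2
      rintro _ ⟨i, rfl⟩
      exact ⟨⟨f i, ht (Finset.mem_image_of_mem f (Finset.mem_univ i))⟩, rfl⟩
    exact (Submodule.mem_span_range_iff_exists_fun ℂ).mp h1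
  choose c hc using key
  refine ⟨t, fun l κ => c κ l, htk, fun j κ => ?_⟩
  have := congrFun (hc κ) j
  simp only [Matrix.row, Finset.sum_apply, Pi.smul_apply, Matrix.transpose_apply, smul_eq_mul]
    at this
  rw [← this]
  exact Finset.sum_congr rfl fun l _ => mul_comm _ _

open scoped Classical in
/-- Contracting a general tensor with nonzero vectors supported on `S` yields no matrix of rank at
most `k`, if the codimension of the matrices of rank at most `k` is at least the cardinality
of `S`. -/
theorem forGeneral_lt_rank_contract (S : Finset I) (k : ℕ) (hJ : k ≤ Fintype.card J)
    (hK : k ≤ Fintype.card K) (hS : S.card ≤ (Fintype.card J - k) * (Fintype.card K - k)) :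
    ForGeneral fun T : I × J × K → ℂ => ∀ a : I → ℂ, a ≠ 0 → (∀ i ∉ S, a i = 0) →
      k < (contract T a).rank := by
  -- Parameters of the bad tensors, with `a` normalised by `a i₀ = 1`: the slices other than `i₀`,
  -- the other coordinates of `a` in `S`, the columns in `t` of the contracted matrix, and the
  -- coefficients expressing its remaining columns through these. The slice `i₀` is then recovered
  -- as the contracted matrix minus the contribution of the other slices.
  let τ (i₀ : I) (t : Finset K) : Type :=
    ({i : I // i ≠ i₀} × J × K) ⊕ ({i : I // i ∈ S.erase i₀}) ⊕ (J × t) ⊕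
      (t × {κ : K // κ ∉ t})
  let A (i₀ : I) (t : Finset K) (j : J) (κ : K) : MvPolynomial (τ i₀ t) ℂ :=
    if h : κ ∈ t then .X (.inr (.inr (.inl (j, ⟨κ, h⟩)))) else
      ∑ l : t, .X (.inr (.inr (.inl (j, l)))) * .X (.inr (.inr (.inr (l, ⟨κ, h⟩))))
  let φ (i₀ : I) (t : Finset K) : I × J × K → MvPolynomial (τ i₀ t) ℂ := fun x =>
    if h : x.1 ≠ i₀ then .X (.inl (⟨x.1, h⟩, x.2)) else
      A i₀ t x.2.1 x.2.2 - ∑ i : {i : I // i ∈ S.erase i₀},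
        .X (.inl (⟨i, Finset.ne_of_mem_erase i.2⟩, x.2)) * .X (.inr (.inl i))
  have hgen : ForGeneral fun T : I × J × K → ℂ =>
      ∀ p : S × {t : Finset K // t.card = k}, ∀ u : τ p.1 p.2 → ℂ,
        T ≠ fun x => MvPolynomial.eval u (φ p.1 p.2 x) := by
    apply ForGeneral.forall_finite
    rintro ⟨⟨i₀, hi₀⟩, t, ht⟩
    apply forGeneral_notMem_range
    have hSpos : 0 < S.card := Finset.card_pos.mpr ⟨i₀, hi₀⟩
    have hcI : 0 < Fintype.card I := Fintype.card_pos_iff.mpr ⟨i₀⟩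
    have e1 : Fintype.card {i : I // i ≠ i₀} = Fintype.card I - 1 := by
      rw [Fintype.card_subtype_compl]; simp
    have e2 : Fintype.card {κ : K // κ ∉ t} = Fintype.card K - k := by
      rw [Fintype.card_subtype_compl]; simp [ht]
    have e3 : Fintype.card {i : I // i ∈ S.erase i₀} = S.card - 1 := by
      rw [Fintype.card_coe, Finset.card_erase_of_mem hi₀]
    have e4 : Fintype.card t = k := by simp [ht]
    -- The count `(|I| - 1)|J||K| + (|S| - 1) + k|J| + k(|K| - k) < |I||J||K|` amounts to `|S| - 1 <
    -- (|J| - k)(|K| - k)`.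
    simp only [τ, Fintype.card_sum, Fintype.card_prod, e1, e2, e3, e4]
    obtain ⟨a, ha⟩ := Nat.exists_eq_add_of_le hJ
    obtain ⟨b, hb⟩ := Nat.exists_eq_add_of_le hK
    obtain ⟨c, hc⟩ := Nat.exists_eq_add_of_le' hcI
    obtain ⟨d, hd⟩ := Nat.exists_eq_add_of_le' hSpos
    rw [ha, hb, hd] at hS
    rw [ha, hb, hc, hd]
    simp only [Nat.add_sub_cancel_left, Nat.add_sub_cancel] at hS ⊢
    nlinarith
  refine hgen.mono fun T hT a ha haS => ?_
  by_contra hrk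
  push Not at hrk
  obtain ⟨i₀, hi₀⟩ := Function.ne_iff.mp ha
  have hi₀S : i₀ ∈ S := by
    by_contra h
    exact hi₀ (haS i₀ h)
  set b : I → ℂ := (a i₀)⁻¹ • a with hb
  have hb0 : b i₀ = 1 := by simpa [hb] using inv_mul_cancel₀ hi₀
  have hbS : ∀ i ∉ S, b i = 0 := fun i hi => by simp [hb, haS i hi]
  have hrk' : (contract T b).rank ≤ k := by
    refine le_trans ?_ hrk
    rw [hb, contract_smul, Matrix.rank_smul_of_mem_nonZeroDivisors _
      (mem_nonZeroDivisors_of_ne_zero (inv_ne_zero hi₀))]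
  obtain ⟨t, C, ht, hC⟩ := exists_columns_of_rank_le _ hrk' hK
  let u : τ i₀ t → ℂ := Sum.elim (fun x => T (x.1, x.2)) (Sum.elim (fun i => b i)
    (Sum.elim (fun x => contract T b x.1 x.2) (fun x => C x.1 x.2)))
  refine hT (⟨i₀, hi₀S⟩, ⟨t, ht⟩) u ?_
  funext ⟨i, j, κ⟩
  have hAeval : MvPolynomial.eval u (A i₀ t j κ) = contract T b j κ := by
    by_cases h : κ ∈ t
    · simp [A, h, u]
    · rw [hC j κ]
      simp [A, h, u]
  change T (i, j, κ) = MvPolynomial.eval u (φ i₀ t (i, j, κ))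
  by_cases h : i = i₀
  · subst h
    simp only [φ, ne_eq, not_true_eq_false, dite_false, map_sub, hAeval, map_sum, map_mul,
      MvPolynomial.eval_X, u, Sum.elim_inl, Sum.elim_inr]
    rw [Finset.sum_coe_sort (S.erase i) fun i' => T (i', j, κ) * b i', eq_sub_iff_add_eq]
    simp only [contract, Matrix.of_apply]
    rw [← Finset.sum_subset (Finset.subset_univ S), ← Finset.add_sum_erase _ _ hi₀S, hb0, mul_one]
    intro i' _ hi'
    rw [hbS i' hi', mul_zero]
  · simp [φ, h, u]

end Tensor

/-! ### Linear sections of determinantal varieties -/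

section Places

variable {L : Type} [Field L] [Algebra ℂ L]

/-- If all `w i` were integral over `ℂ[l]`, they would lie in a ring with the transcendence degree
of `ℂ[l]`, which is at most the number of the `l`. -/
theorem exists_not_isIntegral_adjoin {ι κ : Type} [Fintype ι] [Fintype κ] {w : ι → L}
    (hw : AlgebraicIndependent ℂ w) (l : κ → L) (h : Fintype.card κ < Fintype.card ι) :
    ∃ i, ¬ IsIntegral (Algebra.adjoin ℂ (Set.range l)) (w i) := by
  by_contra hcon
  push Not at hcon
  let S := Algebra.adjoin ℂ (Set.range l)
  let A := integralClosure S L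
  let w' : ι → A := fun i => ⟨w i, hcon i⟩
  have hw' : AlgebraicIndependent ℂ w' := by
    apply AlgebraicIndependent.of_comp (IsScalarTower.toAlgHom ℂ A L)
    exact hw
  have h1 := hw'.cardinalMk_le_trdeg
  have : Algebra.IsIntegral S A := inferInstance
  have : FaithfulSMul ℂ S :=
    (faithfulSMul_iff_algebraMap_injective ℂ S).mpr (algebraMap ℂ S).injective
  have : FaithfulSMul S A := (faithfulSMul_iff_algebraMap_injective S A).mpr fun x y h =>
    Subtype.ext (congrArg (Subtype.val : A → L) h)
  rw [← trdeg_add_eq ℂ S, trdeg_eq_zero (R := S), add_zero] at h1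
  have hsurj : Function.Surjective ((MvPolynomial.aeval l : MvPolynomial κ ℂ →ₐ[ℂ] L).rangeRestrict) :=
    AlgHom.rangeRestrict_surjective _
  have h2 := trdeg_le_of_surjective _ hsurj
  rw [← Algebra.adjoin_range_eq_range_aeval, MvPolynomial.trdeg_of_isDomain] at h2
  have h3 := h1.trans h2
  simp only [Cardinal.mk_fintype, Cardinal.lift_natCast, Nat.cast_le] at h3
  omega

/-- An integrally closed subring is an intersection of valuation rings, so an element that is not
integral over `ℂ[l]` has a pole at some place where all `l t` are finite. -/
theorem exists_valuationSubring {ι κ : Type} [Fintype ι] [Fintype κ] {w : ι → L}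
    (hw : AlgebraicIndependent ℂ w) (l : κ → L) (h : Fintype.card κ < Fintype.card ι) :
    ∃ O : ValuationSubring L, (∀ c : ℂ, algebraMap ℂ L c ∈ O) ∧ (∀ t, l t ∈ O) ∧
      ∃ i, w i ∉ O := by
  obtain ⟨i, hi⟩ := exists_not_isIntegral_adjoin hw l h
  have hi' : w i ∉ (integralClosure (Algebra.adjoin ℂ (Set.range l)) L).toSubring := hi
  obtain ⟨O, hO, hiO⟩ := Subring.exists_le_valuationSubring_of_isIntegrallyClosedIn hi'
  have hS : ∀ x ∈ Algebra.adjoin ℂ (Set.range l), x ∈ O := fun x hx =>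
    hO ((integralClosure (Algebra.adjoin ℂ (Set.range l)) L).algebraMap_mem ⟨x, hx⟩)
  exact ⟨O, fun c => hS _ (Subalgebra.algebraMap_mem _ c),
    fun t => hS _ (Algebra.subset_adjoin ⟨t, rfl⟩), i, hiO⟩

end Places

/-- A system of polynomial equations which has a solution in an extension field has a solution. -/
theorem exists_zero_of_exists_zero_extension {σ : Type} [Finite σ] {E : Type*} [Field E]
    (χ : ℂ →+* E) (S : Set (MvPolynomial σ ℂ)) (x : σ → E)
    (hx : ∀ p ∈ S, MvPolynomial.eval₂ χ x p = 0) :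
    ∃ y : σ → ℂ, ∀ p ∈ S, MvPolynomial.eval y p = 0 := by
  by_contra hcon
  have h0 : MvPolynomial.zeroLocus ℂ (Ideal.span S) = ∅ := by
    rw [MvPolynomial.zeroLocus_span, Set.eq_empty_iff_forall_notMem]
    intro y hy
    exact hcon ⟨y, fun p hp => by simpa [MvPolynomial.coe_aeval_eq_eval] using hy p hp⟩
  -- By the Nullstellensatz, a system without complex solutions generates the unit ideal, which
  -- excludes solutions in `E` as well.
  have h1 : (1 : MvPolynomial σ ℂ) ∈ (Ideal.span S).radical := by
    rw [← MvPolynomial.vanishingIdeal_zeroLocus_eq_radical (K := ℂ), h0]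
    intro y hy
    exact hy.elim
  have h2 : (1 : MvPolynomial σ ℂ) ∈ Ideal.span S := by
    rw [← Ideal.eq_top_iff_one, Ideal.radical_eq_top] at h1
    rw [h1]; trivial
  have h3 : Ideal.span S ≤ RingHom.ker (MvPolynomial.eval₂Hom χ x) := Ideal.span_le.mpr hx
  have h4 := h3 h2
  rw [RingHom.mem_ker, map_one] at h4
  exact one_ne_zero h4

section Generic

variable {J K : Type} [Fintype J] [Fintype K]

/-- The generic matrix of rank at most `k`. -/
def genericProduct (J K : Type) (k : ℕ) :
    Matrix J K (MvPolynomial ((J × Fin k) ⊕ (Fin k × K)) ℂ) :=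
  Matrix.of fun j κ => ∑ l, MvPolynomial.X (Sum.inl (j, l)) * MvPolynomial.X (Sum.inr (l, κ))

omit [Fintype J] [Fintype K] in
-- In a matrix of rank at most `k`, the entries of `k` rows and `k` columns can be prescribed freely
-- as long as the block `W` where they cross is invertible. A relation `P` between these entries
-- therefore vanishes wherever `det W ≠ 0`, whence `P * det W = 0`. These entries number `k(p + q -
-- k)`, the dimension of the determinantal variety.
theorem algebraicIndependent_genericProduct {k : ℕ} (e : Fin k ↪ J) (e' : Fin k ↪ K) :
    AlgebraicIndependent ℂ
      fun x : {x : J × K // x.1 ∈ Set.range e ∨ x.2 ∈ Set.range e'} =>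
        genericProduct J K k x.1.1 x.1.2 := by
  classical
  rw [algebraicIndependent_iff]
  intro P hP
  let Φ := {x : J × K // x.1 ∈ Set.range e ∨ x.2 ∈ Set.range e'}
  let W : Matrix (Fin k) (Fin k) (MvPolynomial Φ ℂ) :=
    Matrix.of fun i l => .X ⟨(e i, e' l), .inl ⟨i, rfl⟩⟩
  have hW : W.det ≠ 0 := by
    intro h
    let u : Φ → ℂ := fun x => if ∃ i, x.1 = (e i, e' i) then 1 else 0
    have h1 := congrArg (MvPolynomial.eval u) h
    rw [map_zero, RingHom.map_det] at h1
    have h2 : (MvPolynomial.eval u).mapMatrix W = 1 := by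
      ext i l
      simp only [W, u, RingHom.mapMatrix_apply, Matrix.map_apply, Matrix.of_apply,
        MvPolynomial.eval_X, Prod.mk.injEq, EmbeddingLike.apply_eq_iff_eq, Matrix.one_apply]
      congr 1
      simp [eq_comm]
    rw [h2, Matrix.det_one] at h1
    exact one_ne_zero h1
  have hprod : P * W.det = 0 := by
    apply MvPolynomial.funext
    intro u
    rw [map_mul, map_zero, RingHom.map_det]
    by_cases hu : ((MvPolynomial.eval u).mapMatrix W).det = 0
    · rw [hu, mul_zero]
    · set W₀ := (MvPolynomial.eval u).mapMatrix W with hW₀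
      have hW₀' : ∀ i l, W₀ i l = u ⟨(e i, e' l), .inl ⟨i, rfl⟩⟩ := fun i l => by
        simp [hW₀, W]
      -- The prescribed columns times `W₀⁻¹` times the prescribed rows has the prescribed entries on
      -- the cross.
      let B : Matrix J (Fin k) ℂ := Matrix.of fun j l => u ⟨(j, e' l), .inr ⟨l, rfl⟩⟩
      let C₀ : Matrix (Fin k) K ℂ := Matrix.of fun i κ => u ⟨(e i, κ), .inl ⟨i, rfl⟩⟩
      let C : Matrix (Fin k) K ℂ := W₀⁻¹ * C₀
      have hunit : IsUnit W₀.det := isUnit_iff_ne_zero.mpr hu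
      have key : ∀ x : Φ, (B * C) x.1.1 x.1.2 = u x := by
        rintro ⟨⟨j, κ⟩, h⟩
        rcases h with ⟨i, hi⟩ | ⟨l, hl⟩
        · dsimp only at hi ⊢
          subst hi
          have h1 : (B * C) (e i) κ = (W₀ * C) i κ := by
            simp only [Matrix.mul_apply, B, Matrix.of_apply, hW₀']
          rw [h1, Matrix.mul_nonsing_inv_cancel_left _ _ hunit]
          rfl
        · dsimp only at hl ⊢
          subst hl
          have h1 : ∀ i, C i (e' l) = (W₀⁻¹ * W₀) i l := fun i => by
            simp only [C, Matrix.mul_apply, C₀, Matrix.of_apply, hW₀']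
          rw [Matrix.mul_apply]
          simp only [h1, Matrix.nonsing_inv_mul _ hunit, Matrix.one_apply, mul_ite, mul_one, mul_zero,
            Finset.sum_ite_eq', Finset.mem_univ, if_true]
          rfl
      let v : (J × Fin k) ⊕ (Fin k × K) → ℂ := Sum.elim (fun x => B x.1 x.2) (fun x => C x.1 x.2)
      have h1 := congrArg (MvPolynomial.eval v) hP
      rw [map_zero, eval_aeval] at h1
      have h2 : (fun x : Φ => MvPolynomial.eval v (genericProduct J K k x.1.1 x.1.2)) = u := by
        funext x
        rw [← key x]
        simp only [genericProduct, Matrix.mul_apply, Matrix.of_apply, map_sum, map_mul,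
          MvPolynomial.eval_X, v, Sum.elim_inl, Sum.elim_inr]
      rw [h2] at h1
      rw [h1, zero_mul]
  exact (mul_eq_zero.mp hprod).resolve_right hW

theorem card_cross {k : ℕ} (e : Fin k ↪ J) (e' : Fin k ↪ K) :
    Nat.card {x : J × K // x.1 ∈ Set.range e ∨ x.2 ∈ Set.range e'} +
      (Fintype.card J - k) * (Fintype.card K - k) = Fintype.card J * Fintype.card K := by
  classical
  have h1 : Nat.card {x : J × K // ¬ (x.1 ∈ Set.range e ∨ x.2 ∈ Set.range e')} =
      (Fintype.card J - k) * (Fintype.card K - k) := by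
    let E : {x : J × K // ¬ (x.1 ∈ Set.range e ∨ x.2 ∈ Set.range e')} ≃
        {j : J // j ∉ Set.range e} × {κ : K // κ ∉ Set.range e'} :=
      { toFun := fun x => (⟨x.1.1, fun h => x.2 (.inl h)⟩, ⟨x.1.2, fun h => x.2 (.inr h)⟩)
        invFun := fun x => ⟨(x.1.1, x.2.1), fun h => h.elim x.1.2 x.2.2⟩
        left_inv := fun x => rfl
        right_inv := fun x => rfl }
    rw [Nat.card_congr E, Nat.card_prod, Nat.card_eq_fintype_card, Nat.card_eq_fintype_card,
      Fintype.card_subtype_compl, Fintype.card_subtype_compl]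
    congr 2
    · rw [← Nat.card_eq_fintype_card]
      exact (Nat.card_range_of_injective e.injective).trans (by simp)
    · rw [← Nat.card_eq_fintype_card]
      exact (Nat.card_range_of_injective e'.injective).trans (by simp)
  rw [← h1, Nat.card_eq_fintype_card, Nat.card_eq_fintype_card, Fintype.card_subtype_compl,
    ← Fintype.card_prod]
  have := Fintype.card_subtype_le fun x : J × K => x.1 ∈ Set.range e ∨ x.2 ∈ Set.range e'
  omega

omit [Fintype J] [Fintype K] in
theorem det_submatrix_genericProduct {k : ℕ} (f : Fin (k + 1) → J) (g : Fin (k + 1) → K) :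
    ((genericProduct J K k).submatrix f g).det = 0 := by
  set R := MvPolynomial ((J × Fin k) ⊕ (Fin k × K)) ℂ
  let L := FractionRing R
  apply IsFractionRing.injective R L
  rw [map_zero, RingHom.map_det]
  let B : Matrix (Fin (k + 1)) (Fin k) L :=
    Matrix.of fun a l => algebraMap R L (MvPolynomial.X (Sum.inl (f a, l)))
  let C : Matrix (Fin k) (Fin (k + 1)) L :=
    Matrix.of fun l b => algebraMap R L (MvPolynomial.X (Sum.inr (l, g b)))
  have h : (algebraMap R L).mapMatrix ((genericProduct J K k).submatrix f g) = B * C := by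
    ext a b
    simp [genericProduct, Matrix.mul_apply, B, C]
  rw [h]
  by_contra hdet
  have h1 : (B * C).rank = Fintype.card (Fin (k + 1)) := Matrix.rank_of_det_ne_zero hdet
  have h2 := (Matrix.rank_mul_le_left B C).trans (Matrix.rank_le_width B)
  rw [h1, Fintype.card_fin] at h2
  omega

/-- A linear subspace whose dimension exceeds the codimension of the matrices of rank at most `k`
contains a nonzero matrix of rank at most `k`. -/
theorem exists_rank_le_of_lt_finrank (V : Submodule ℂ (Matrix J K ℂ)) {k : ℕ}
    (hJ : k ≤ Fintype.card J) (hK : k ≤ Fintype.card K)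
    (hV : (Fintype.card J - k) * (Fintype.card K - k) < Module.finrank ℂ V) :
    ∃ A ∈ V, A ≠ 0 ∧ A.rank ≤ k := by
  classical
  let R := MvPolynomial ((J × Fin k) ⊕ (Fin k × K)) ℂ
  let L := FractionRing R
  obtain ⟨e⟩ : Nonempty (Fin k ↪ J) := Function.Embedding.nonempty_of_card_le (by simpa using hJ)
  obtain ⟨e'⟩ : Nonempty (Fin k ↪ K) := Function.Embedding.nonempty_of_card_le (by simpa using hK)
  let z : J → K → L := fun j κ => algebraMap R L (genericProduct J K k j κ)
  have hz : AlgebraicIndependent ℂ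
      fun x : {x : J × K // x.1 ∈ Set.range e ∨ x.2 ∈ Set.range e'} => z x.1.1 x.1.2 :=
    (algebraicIndependent_genericProduct e e').map' (f := IsScalarTower.toAlgHom ℂ R L)
      (IsFractionRing.injective R L)
  -- linear equations for `V`
  let Q := Matrix J K ℂ ⧸ V
  let bQ := Module.finBasis ℂ Q
  let c : Fin (Module.finrank ℂ Q) → J → K → ℂ := fun t j κ =>
    bQ.repr (V.mkQ (Matrix.single j κ 1)) t
  have hc : ∀ A : Matrix J K ℂ, (∀ t, ∑ j, ∑ κ, c t j κ * A j κ = 0) → A ∈ V := by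
    intro A hA
    rw [← Submodule.ker_mkQ V, LinearMap.mem_ker]
    apply bQ.ext_elem
    intro t
    rw [map_zero, Finsupp.zero_apply, ← hA t]
    conv_lhs => rw [Matrix.matrix_eq_sum_single A]
    simp only [map_sum, Finsupp.coe_finsetSum, Finset.sum_apply, c]
    refine Finset.sum_congr rfl fun j _ => Finset.sum_congr rfl fun κ _ => ?_
    have : Matrix.single j κ (A j κ) = A j κ • Matrix.single j κ (1 : ℂ) := by
      rw [Matrix.smul_single, smul_eq_mul, mul_one]
    rw [this, map_smul, map_smul, Finsupp.smul_apply, smul_eq_mul, mul_comm]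
  let l : Fin (Module.finrank ℂ Q) → L := fun t => ∑ j, ∑ κ, algebraMap ℂ L (c t j κ) * z j κ
  -- There are `pq - dim V` equations for `V` and `pq - (p - k)(q - k)` independent entries. With
  -- fewer equations than independent entries, some place keeps the equations' values `l` finite and
  -- gives an entry a pole.
  have hcard : Fintype.card (Fin (Module.finrank ℂ Q)) <
      Fintype.card {x : J × K // x.1 ∈ Set.range e ∨ x.2 ∈ Set.range e'} := by
    have h1 := card_cross e e'
    have h2 := V.finrank_quotient_add_finrank
    rw [Module.finrank_matrix, Module.finrank_self, mul_one] at h2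
    rw [Nat.card_eq_fintype_card] at h1
    rw [Fintype.card_fin]
    change Module.finrank ℂ Q + _ = _ at h2
    omega
  obtain ⟨O, hCO, hlO, ⟨⟨x₀, hx₀⟩, hzx⟩⟩ := exists_valuationSubring hz l hcard
  -- an entry of largest valuation
  have : Nonempty (J × K) := ⟨x₀⟩
  obtain ⟨m, hm⟩ := Finite.exists_max fun x : J × K => O.valuation (z x.1 x.2)
  have hm1 : 1 < O.valuation (z m.1 m.2) := by
    refine lt_of_lt_of_le ?_ (hm x₀)
    rw [← not_le, O.valuation_le_one_iff]
    exact hzx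
  have hm0 : z m.1 m.2 ≠ 0 := by
    intro h
    rw [h, map_zero] at hm1
    exact not_lt_zero hm1
  have hw : ∀ j κ, z j κ * (z m.1 m.2)⁻¹ ∈ O := by
    intro j κ
    rw [← O.valuation_le_one_iff, map_mul, map_inv₀]
    exact mul_inv_le_one_of_le₀ (hm (j, κ)) zero_le
  have hminv : O.valuation (z m.1 m.2)⁻¹ < 1 := by
    rw [map_inv₀]
    exact inv_lt_one_of_one_lt₀ hm1
  -- After division by the largest entry, the matrix reduces to the residue field: entry `m` becomes
  -- `1`, the minors of size `k + 1` still vanish, and the equations of `V` now hold because finite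
  -- values have been divided by an infinite one. The Nullstellensatz then yields a complex matrix
  -- with these properties.
  let w : J → K → O := fun j κ => ⟨_, hw j κ⟩
  let ρ := IsLocalRing.residue O
  let ι : ℂ →+* O := (algebraMap ℂ L).codRestrict O.toSubring hCO
  let χ : ℂ →+* IsLocalRing.ResidueField O := ρ.comp ι
  let D (p : (Fin (k + 1) → J) × (Fin (k + 1) → K)) : MvPolynomial (J × K) ℂ :=
    (Matrix.of fun a b => MvPolynomial.X (p.1 a, p.2 b)).det
  let lin (t : Fin (Module.finrank ℂ Q)) : MvPolynomial (J × K) ℂ :=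
    ∑ j, ∑ κ, MvPolynomial.C (c t j κ) * MvPolynomial.X (j, κ)
  obtain ⟨y, hy⟩ := exists_zero_of_exists_zero_extension χ
    ({MvPolynomial.X m - 1} ∪ Set.range D ∪ Set.range lin) (fun x => ρ (w x.1 x.2)) (by
      rintro p ((hp | ⟨p, rfl⟩) | ⟨t, rfl⟩)
      · rw [Set.mem_singleton_iff] at hp
        subst hp
        rw [MvPolynomial.eval₂_sub, MvPolynomial.eval₂_X, MvPolynomial.eval₂_one, sub_eq_zero]
        have : w m.1 m.2 = 1 := Subtype.ext (mul_inv_cancel₀ hm0)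
        rw [this, map_one]
      · have h1 : (Matrix.of fun a b => w (p.1 a) (p.2 b)).det = 0 := by
          apply O.subtype_injective
          rw [map_zero, RingHom.map_det]
          have h2 : O.subtype.mapMatrix (Matrix.of fun a b => w (p.1 a) (p.2 b)) =
              (z m.1 m.2)⁻¹ • (algebraMap R L).mapMatrix
                ((genericProduct J K k).submatrix p.1 p.2) := by
            ext a b
            simp [w, z, mul_comm]
          rw [h2, Matrix.det_smul, ← RingHom.map_det, det_submatrix_genericProduct, map_zero,
            mul_zero]
        have h2 := congrArg ρ h1
        rw [map_zero, RingHom.map_det] at h2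
        rw [← MvPolynomial.coe_eval₂Hom, RingHom.map_det, ← h2]
        congr 1
        ext a b
        simp
      · have h1 : ∑ j, ∑ κ, ι (c t j κ) * w j κ ∈ IsLocalRing.maximalIdeal O := by
          rw [O.valuation_lt_one_iff]
          have h2 : ((∑ j, ∑ κ, ι (c t j κ) * w j κ : O) : L) = l t * (z m.1 m.2)⁻¹ := by
            rw [← O.subtype_apply, map_sum, Finset.sum_mul]
            refine Finset.sum_congr rfl fun j _ => ?_
            rw [map_sum, Finset.sum_mul]
            refine Finset.sum_congr rfl fun κ _ => ?_
            rw [map_mul, mul_assoc]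
            rfl
          rw [h2, map_mul]
          exact (mul_le_of_le_one_left' ((O.valuation_le_one_iff _).mpr (hlO t))).trans_lt hminv
        rw [← IsLocalRing.residue_eq_zero_iff] at h1
        rw [← h1]
        simp [lin, MvPolynomial.eval₂_sum, χ, ρ])
  let A : Matrix J K ℂ := Matrix.of fun j κ => y (j, κ)
  refine ⟨A, hc A fun t => ?_, fun h => ?_, ?_⟩
  · have h1 := hy _ (.inr ⟨t, rfl⟩)
    simpa [lin, A] using h1
  · have h1 := hy _ (.inl (.inl rfl))
    have h2 := congrFun (congrFun h m.1) m.2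
    simp only [A, Matrix.of_apply, Matrix.zero_apply] at h2
    simp [h2] at h1
  · by_contra hrk
    push Not at hrk
    obtain ⟨f, g, -, -, hdet⟩ := exists_minor_ne_zero A hrk
    apply hdet
    have h1 := hy _ (.inl (.inr ⟨(f, g), rfl⟩))
    rw [RingHom.map_det] at h1
    rw [← h1]
    congr 1
    ext a b
    simp [A]

end Generic

section Tensor

variable {I J K : Type} [Fintype I] [Fintype J] [Fintype K]

open scoped Classical in
-- Either contraction is injective on vectors supported on `S`, and its image is a subspace of
-- dimension `|S|`, or a nonzero vector contracts to the zero matrix.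
theorem exists_rank_contract_le (T : I × J × K → ℂ) (S : Finset I) {k : ℕ}
    (hJ : k ≤ Fintype.card J) (hK : k ≤ Fintype.card K)
    (hS : (Fintype.card J - k) * (Fintype.card K - k) < S.card) :
    ∃ a : I → ℂ, a ≠ 0 ∧ (∀ i ∉ S, a i = 0) ∧ (contract T a).rank ≤ k := by
  let g : (S → ℂ) →ₗ[ℂ] (I → ℂ) := Function.ExtendByZero.linearMap ℂ Subtype.val
  have hg : ∀ b i, g b i = if h : i ∈ S then b ⟨i, h⟩ else 0 := by
    intro b i
    by_cases h : i ∈ S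
    · rw [dif_pos h]
      exact Subtype.val_injective.extend_apply b 0 ⟨i, h⟩
    · rw [dif_neg h]
      exact Function.extend_apply' _ _ _ fun ⟨x, hx⟩ => h (hx ▸ x.2)
  have hginj : ∀ b, b ≠ 0 → g b ≠ 0 := by
    intro b hb h
    apply hb
    funext i
    have := congrFun h i
    rwa [hg, dif_pos i.2] at this
  have hgS : ∀ b, ∀ i ∉ S, g b i = 0 := fun b i hi => by rw [hg, dif_neg hi]
  let Λ : (S → ℂ) →ₗ[ℂ] Matrix J K ℂ :=
    { toFun := fun b => contract T (g b)
      map_add' := fun b b' => by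
        ext j κ
        simp [contract, mul_add, Finset.sum_add_distrib]
      map_smul' := fun c b => by
        rw [map_smul, contract_smul, RingHom.id_apply] }
  by_cases hinj : Function.Injective Λ
  · obtain ⟨A, ⟨b, rfl⟩, hA0, hA⟩ := exists_rank_le_of_lt_finrank (LinearMap.range Λ) hJ hK (by
      rw [LinearMap.finrank_range_of_inj hinj]
      simpa using hS)
    refine ⟨g b, hginj b ?_, hgS b, hA⟩
    rintro rfl
    exact hA0 (map_zero Λ)
  · rw [← LinearMap.ker_eq_bot, Submodule.eq_bot_iff] at hinj
    push Not at hinj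
    obtain ⟨b, hb, hb0⟩ := hinj
    refine ⟨g b, hginj b hb0, hgS b, ?_⟩
    have h : contract T (g b) = 0 := hb
    rw [h, Matrix.rank_zero]
    exact Nat.zero_le _

end Tensor

/-! ### The Zariski topology on projective space -/

section Zariski

variable {ι κ : Type}

theorem eval_rep_mk_ne_zero {F : MvPolynomial ι ℂ} {d : ℕ} (hF : F.IsHomogeneous d)
    (v : ι → ℂ) (hv : v ≠ 0) :
    MvPolynomial.eval (Projectivization.mk ℂ v hv).rep F ≠ 0 ↔ MvPolynomial.eval v F ≠ 0 := by
  obtain ⟨a, ha⟩ := Projectivization.exists_smul_eq_mk_rep ℂ v hv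
  rw [← ha, Units.smul_def, eval_smul_of_isHomogeneous hF]
  simp

theorem isOpen_ne_zero {F : MvPolynomial ι ℂ} {d : ℕ} (hF : F.IsHomogeneous d) :
    IsOpen {x : ℙ ℂ (ι → ℂ) | MvPolynomial.eval x.rep F ≠ 0} :=
  TopologicalSpace.isOpen_generateFrom_of_mem ⟨F, d, hF, rfl⟩

theorem isClosed_eq_zero {F : MvPolynomial ι ℂ} {d : ℕ} (hF : F.IsHomogeneous d) :
    IsClosed {x : ℙ ℂ (ι → ℂ) | MvPolynomial.eval x.rep F = 0} := by
  have h := (isOpen_ne_zero hF).isClosed_compl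
  have h' : {x : ℙ ℂ (ι → ℂ) | MvPolynomial.eval x.rep F = 0} =
      {x : ℙ ℂ (ι → ℂ) | MvPolynomial.eval x.rep F ≠ 0}ᶜ := by
    ext x
    simp
  rwa [h']

theorem isTopologicalBasis_ne_zero :
    TopologicalSpace.IsTopologicalBasis
      {U : Set (ℙ ℂ (ι → ℂ)) | ∃ (F : MvPolynomial ι ℂ) (d : ℕ), F.IsHomogeneous d ∧
        U = {x | MvPolynomial.eval x.rep F ≠ 0}} where
  exists_subset_inter := by
    rintro _ ⟨F, d, hF, rfl⟩ _ ⟨G, e, hG, rfl⟩ x ⟨hx, hx'⟩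
    refine ⟨_, ⟨F * G, d + e, hF.mul hG, rfl⟩, ?_, ?_⟩
    · simp only [Set.mem_ofPred_eq, map_mul]
      exact mul_ne_zero hx hx'
    · intro y hy
      simp only [Set.mem_ofPred_eq, map_mul] at hy
      exact ⟨left_ne_zero_of_mul hy, right_ne_zero_of_mul hy⟩
  sUnion_eq := by
    rw [Set.sUnion_eq_univ_iff]
    intro x
    exact ⟨_, ⟨1, 0, MvPolynomial.isHomogeneous_one _ _, rfl⟩, by simp⟩
  eq_generateFrom := rfl

theorem exists_ne_zero_of_mem_isOpen {U : Set (ℙ ℂ (ι → ℂ))} (hU : IsOpen U) {x : ℙ ℂ (ι → ℂ)}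
    (hx : x ∈ U) :
    ∃ (F : MvPolynomial ι ℂ) (d : ℕ), F.IsHomogeneous d ∧ MvPolynomial.eval x.rep F ≠ 0 ∧
      ∀ y : ℙ ℂ (ι → ℂ), MvPolynomial.eval y.rep F ≠ 0 → y ∈ U := by
  obtain ⟨_, ⟨F, d, hF, rfl⟩, hxF, hFU⟩ := isTopologicalBasis_ne_zero.exists_subset_of_mem_open hx hU
  exact ⟨F, d, hF, hxF, fun y hy => hFU hy⟩

section LinearMaps

variable [Fintype ι] [DecidableEq ι]

/-- The coordinates of a linear map, as linear forms. -/
def linearForms (Λ : (ι → ℂ) →ₗ[ℂ] (κ → ℂ)) (k : κ) : MvPolynomial ι ℂ :=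
  ∑ i, MvPolynomial.C (Λ (Pi.single i 1) k) * MvPolynomial.X i

theorem eval_linearForms (Λ : (ι → ℂ) →ₗ[ℂ] (κ → ℂ)) (k : κ) (v : ι → ℂ) :
    MvPolynomial.eval v (linearForms Λ k) = Λ v k := by
  conv_rhs => rw [pi_eq_sum_univ' v, map_sum]
  simp [linearForms, mul_comm]

theorem isHomogeneous_linearForms (Λ : (ι → ℂ) →ₗ[ℂ] (κ → ℂ)) (k : κ) :
    (linearForms Λ k).IsHomogeneous 1 :=
  MvPolynomial.IsHomogeneous.sum _ _ _ fun i _ => by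
    simpa using (MvPolynomial.isHomogeneous_X ℂ i).C_mul (Λ (Pi.single i 1) k)

theorem isHomogeneous_aeval_linearForms (Λ : (ι → ℂ) →ₗ[ℂ] (κ → ℂ)) {F : MvPolynomial κ ℂ}
    {d : ℕ} (hF : F.IsHomogeneous d) :
    (MvPolynomial.aeval (linearForms Λ) F).IsHomogeneous d := by
  simpa using hF.aeval _ (isHomogeneous_linearForms Λ)

theorem eval_aeval_linearForms (Λ : (ι → ℂ) →ₗ[ℂ] (κ → ℂ)) (F : MvPolynomial κ ℂ) (v : ι → ℂ) :
    MvPolynomial.eval v (MvPolynomial.aeval (linearForms Λ) F) = MvPolynomial.eval (Λ v) F := by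
  rw [eval_aeval]
  congr 2
  funext k
  exact eval_linearForms Λ k v

theorem continuous_map (Λ : (ι → ℂ) →ₗ[ℂ] (κ → ℂ)) (hΛ : Function.Injective Λ) :
    Continuous (Projectivization.map Λ hΛ) := by
  rw [continuous_generateFrom_iff]
  rintro _ ⟨F, d, hF, rfl⟩
  have h : Projectivization.map Λ hΛ ⁻¹' {x | MvPolynomial.eval x.rep F ≠ 0} =
      {x | MvPolynomial.eval x.rep (MvPolynomial.aeval (linearForms Λ) F) ≠ 0} := by
    ext x
    induction x using Projectivization.ind with
    | h v hv =>
      simp only [Set.mem_preimage, Set.mem_ofPred_eq, Projectivization.map_mk]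
      rw [eval_rep_mk_ne_zero hF, eval_rep_mk_ne_zero (isHomogeneous_aeval_linearForms Λ hF),
        eval_aeval_linearForms]
  rw [h]
  exact isOpen_ne_zero (isHomogeneous_aeval_linearForms Λ hF)

/-- A linear left inverse of `Λ` extends each form on the source to a form on the target. -/
theorem isInducing_map [Fintype κ] [DecidableEq κ] (Λ : (ι → ℂ) →ₗ[ℂ] (κ → ℂ))
    (hΛ : Function.Injective Λ) : Topology.IsInducing (Projectivization.map Λ hΛ) := by
  refine ⟨le_antisymm (continuous_iff_le_induced.mp (continuous_map Λ hΛ)) ?_⟩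
  apply le_generateFrom
  rintro _ ⟨F, d, hF, rfl⟩
  obtain ⟨Λ', hΛ'⟩ := Λ.exists_leftInverse_of_injective (LinearMap.ker_eq_bot.mpr hΛ)
  refine ⟨_, isOpen_ne_zero (isHomogeneous_aeval_linearForms Λ' hF), ?_⟩
  ext x
  induction x using Projectivization.ind with
  | h v hv =>
    simp only [Set.mem_preimage, Set.mem_ofPred_eq, Projectivization.map_mk]
    rw [eval_rep_mk_ne_zero hF, eval_rep_mk_ne_zero (isHomogeneous_aeval_linearForms Λ' hF),
      eval_aeval_linearForms]
    have : Λ' (Λ v) = v := LinearMap.congr_fun hΛ' v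
    rw [this]

omit [Fintype ι] [DecidableEq ι] in
theorem rep_mk_mem_iff (V : Submodule ℂ (ι → ℂ)) (v : ι → ℂ) (hv : v ≠ 0) :
    (Projectivization.mk ℂ v hv).rep ∈ V ↔ v ∈ V := by
  obtain ⟨a, ha⟩ := Projectivization.exists_smul_eq_mk_rep ℂ v hv
  rw [← ha, Units.smul_def]
  exact V.smul_mem_iff a.ne_zero

theorem isClosed_rep_mem_ker (Λ : (ι → ℂ) →ₗ[ℂ] (κ → ℂ)) :
    IsClosed {x : ℙ ℂ (ι → ℂ) | x.rep ∈ LinearMap.ker Λ} := by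
  have h : {x : ℙ ℂ (ι → ℂ) | x.rep ∈ LinearMap.ker Λ} =
      ⋂ k, {x | MvPolynomial.eval x.rep (linearForms Λ k) = 0} := by
    ext x
    simp only [Set.mem_ofPred_eq, LinearMap.mem_ker, Set.mem_iInter, eval_linearForms]
    exact ⟨fun h k => by rw [h]; rfl, fun h => funext h⟩
  rw [h]
  exact isClosed_iInter fun k => isClosed_eq_zero (isHomogeneous_linearForms Λ k)

theorem isIrreducible_rep_mem {V : Submodule ℂ (ι → ℂ)} (hV : V ≠ ⊥) :
    IsIrreducible {x : ℙ ℂ (ι → ℂ) | x.rep ∈ V} := by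
  obtain ⟨v₀, hv₀, hne⟩ := V.exists_mem_ne_zero_of_ne_bot hV
  refine ⟨⟨Projectivization.mk ℂ v₀ hne, (rep_mk_mem_iff V v₀ hne).mpr hv₀⟩, ?_⟩
  rintro U U' hU hU' ⟨x, hxV, hx⟩ ⟨x', hxV', hx'⟩
  obtain ⟨F, d, hF, hxF, hFU⟩ := exists_ne_zero_of_mem_isOpen hU hx
  obtain ⟨G, e, hG, hxG, hGU⟩ := exists_ne_zero_of_mem_isOpen hU' hx'
  obtain ⟨p, hp⟩ := V.exists_isCompl
  let π : (ι → ℂ) →ₗ[ℂ] (ι → ℂ) := V.subtype ∘ₗ V.projectionOnto p hp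
  have hπ : ∀ v ∈ V, π v = v := fun v hv => by
    exact congrArg Subtype.val (Submodule.projectionOnto_apply_left hp ⟨v, hv⟩)
  have hπV : ∀ v, π v ∈ V := fun v => by simp [π]
  obtain ⟨i, hi⟩ := Function.ne_iff.mp hne
  -- Composition with the projection `π` onto `V` turns nonvanishing at points of `V` into
  -- nonvanishing of polynomials, whose product is again nonzero. The last factor ensures `π u ≠ 0`,
  -- so that `π u` defines a point.
  have hprod : MvPolynomial.aeval (linearForms π) F * MvPolynomial.aeval (linearForms π) G *
      linearForms π i ≠ 0 := by
    refine mul_ne_zero (mul_ne_zero ?_ ?_) ?_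
    · intro h
      apply hxF
      rw [← hπ _ hxV, ← eval_aeval_linearForms, h, map_zero]
    · intro h
      apply hxG
      rw [← hπ _ hxV', ← eval_aeval_linearForms, h, map_zero]
    · intro h
      apply hi
      rw [← hπ _ hv₀, ← eval_linearForms, h, map_zero]
      rfl
  obtain ⟨u, hu⟩ : ∃ u : ι → ℂ, MvPolynomial.eval u (MvPolynomial.aeval (linearForms π) F *
      MvPolynomial.aeval (linearForms π) G * linearForms π i) ≠ 0 := by
    by_contra hcon
    push Not at hcon
    exact hprod (MvPolynomial.funext fun u => by rw [hcon u, map_zero])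
  simp only [map_mul, eval_aeval_linearForms, eval_linearForms] at hu
  have hu0 : π u ≠ 0 := fun h => right_ne_zero_of_mul hu (by rw [h]; rfl)
  refine ⟨Projectivization.mk ℂ (π u) hu0, (rep_mk_mem_iff V _ hu0).mpr (hπV u), hFU _ ?_, hGU _ ?_⟩
  · exact (eval_rep_mk_ne_zero hF _ _).mpr (left_ne_zero_of_mul (left_ne_zero_of_mul hu))
  · exact (eval_rep_mk_ne_zero hG _ _).mpr (right_ne_zero_of_mul (left_ne_zero_of_mul hu))

end LinearMaps

end Zariski

/-! ### The dimension of projective space -/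

section Dimension

variable {ι : Type}

/-- The ideal of the affine cone over a subset of projective space. -/
def coneIdeal (Z : Set (ℙ ℂ (ι → ℂ))) : Ideal (MvPolynomial ι ℂ) where
  carrier := {F | ∀ x ∈ Z, ∀ c : ℂ, MvPolynomial.eval (c • x.rep) F = 0}
  add_mem' hF hG x hx c := by rw [map_add, hF x hx c, hG x hx c, add_zero]
  zero_mem' x _ c := map_zero _
  smul_mem' F G hG x hx c := by rw [smul_eq_mul, map_mul, hG x hx c, mul_zero]

theorem mem_coneIdeal_iff {Z : Set (ℙ ℂ (ι → ℂ))} {F : MvPolynomial ι ℂ} {d : ℕ}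
    (hF : F.IsHomogeneous d) :
    F ∈ coneIdeal Z ↔ ∀ x ∈ Z, MvPolynomial.eval x.rep F = 0 := by
  refine ⟨fun h x hx => by simpa using h x hx 1, fun h x hx c => ?_⟩
  rw [eval_smul_of_isHomogeneous hF, h x hx, mul_zero]

/-- On the line through `x.rep`, `F` is a polynomial in the scalar `c` whose coefficients are the
values of the components. It vanishes for all `c`, so each coefficient is zero. -/
theorem homogeneousComponent_mem_coneIdeal {Z : Set (ℙ ℂ (ι → ℂ))} {F : MvPolynomial ι ℂ}
    (hF : F ∈ coneIdeal Z) (d : ℕ) : MvPolynomial.homogeneousComponent d F ∈ coneIdeal Z := by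
  rw [mem_coneIdeal_iff (MvPolynomial.homogeneousComponent_isHomogeneous d F)]
  intro x hx
  let p : Polynomial ℂ := ∑ i ∈ Finset.range (F.totalDegree + 1),
    Polynomial.monomial i (MvPolynomial.eval x.rep (MvPolynomial.homogeneousComponent i F))
  have hp : p = 0 := by
    apply Polynomial.funext
    intro c
    rw [Polynomial.eval_zero, ← hF x hx c]
    conv_rhs => rw [← MvPolynomial.sum_homogeneousComponent F]
    rw [map_sum, Polynomial.eval_finsetSum]
    refine Finset.sum_congr rfl fun i _ => ?_
    rw [Polynomial.eval_monomial,
      eval_smul_of_isHomogeneous (MvPolynomial.homogeneousComponent_isHomogeneous i F), mul_comm]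
  by_cases hd : d < F.totalDegree + 1
  · have h := congrArg (Polynomial.coeff · d) hp
    simpa [p, Polynomial.finsetSum_coeff, Polynomial.coeff_monomial, hd] using h
  · rw [MvPolynomial.homogeneousComponent_eq_zero _ _ (by omega), map_zero]

theorem isPrime_coneIdeal {Z : Set (ℙ ℂ (ι → ℂ))} (hZ : IsIrreducible Z) :
    (coneIdeal Z).IsPrime := by
  classical
  let := MvPolynomial.gradedAlgebra (σ := ι) (R := ℂ)
  apply Ideal.IsHomogeneous.isPrime_of_homogeneous_mem_or_mem
    (𝒜 := MvPolynomial.homogeneousSubmodule ι ℂ)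
  · intro i F hF
    have := homogeneousComponent_mem_coneIdeal hF i
    rw [← MvPolynomial.decomposition.decompose'_apply] at this
    exact this
  · intro h
    obtain ⟨x, hx⟩ := hZ.nonempty
    have h1 : (1 : MvPolynomial ι ℂ) ∈ coneIdeal Z := by rw [h]; trivial
    have h2 := h1 x hx 1
    rw [map_one] at h2
    exact one_ne_zero h2
  · rintro F G ⟨d, hF⟩ ⟨e, hG⟩ hFG
    rw [MvPolynomial.mem_homogeneousSubmodule] at hF hG
    rw [mem_coneIdeal_iff hF, mem_coneIdeal_iff hG]
    rw [mem_coneIdeal_iff (hF.mul hG)] at hFG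
    by_contra! ⟨⟨x, hx, hxF⟩, ⟨y, hy, hyG⟩⟩
    obtain ⟨z, hz, hzF, hzG⟩ := hZ.2 _ _ (isOpen_ne_zero hF) (isOpen_ne_zero hG) ⟨x, hx, hxF⟩
      ⟨y, hy, hyG⟩
    have h := hFG z hz
    rw [map_mul] at h
    exact mul_ne_zero hzF hzG h

theorem coneIdeal_anti {Z Z' : Set (ℙ ℂ (ι → ℂ))} (h : Z ⊆ Z') : coneIdeal Z' ≤ coneIdeal Z :=
  fun _ hF x hx => hF x (h hx)

theorem subset_of_coneIdeal_le {Z Z' : Set (ℙ ℂ (ι → ℂ))} (hZ : IsClosed Z)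
    (h : coneIdeal Z ≤ coneIdeal Z') : Z' ⊆ Z := by
  intro x hx
  by_contra hxZ
  obtain ⟨F, d, hF, hxF, hFZ⟩ := exists_ne_zero_of_mem_isOpen hZ.isOpen_compl hxZ
  refine hxF ((mem_coneIdeal_iff hF).mp (h ((mem_coneIdeal_iff hF).mpr fun y hy => ?_)) x hx)
  by_contra hy'
  exact hFZ y hy' hy

open TopologicalSpace in
theorem topologicalKrullDim_add_one_le [Fintype ι] [Nonempty ι] :
    topologicalKrullDim (ℙ ℂ (ι → ℂ)) + 1 ≤ Fintype.card ι := by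
  classical
  have : Nonempty (IrreducibleCloseds (ℙ ℂ (ι → ℂ))) :=
    ⟨⟨{x | x.rep ∈ (⊤ : Submodule ℂ (ι → ℂ))}, isIrreducible_rep_mem top_ne_bot, by simp⟩⟩
  let irr : PrimeSpectrum (MvPolynomial ι ℂ) :=
    ⟨RingHom.ker (MvPolynomial.eval (0 : ι → ℂ)), RingHom.ker_isPrime _⟩
  -- The added bottom element goes to the ideal of the origin, which strictly contains every cone
  -- ideal. It lengthens each chain by one and accounts for the `+ 1`.
  let f : WithBot (IrreducibleCloseds (ℙ ℂ (ι → ℂ))) → (PrimeSpectrum (MvPolynomial ι ℂ))ᵒᵈ :=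
    WithBot.recBotCoe (OrderDual.toDual irr)
      fun Z => OrderDual.toDual ⟨coneIdeal (Z : Set (ℙ ℂ (ι → ℂ))), isPrime_coneIdeal Z.2⟩
  have hf : StrictMono f := by
    intro a b hab
    induction b using WithBot.recBotCoe with
    | bot => exact absurd hab not_lt_bot
    | coe Z' =>
      induction a using WithBot.recBotCoe with
      | bot =>
        change (coneIdeal (Z' : Set (ℙ ℂ (ι → ℂ)))) < RingHom.ker _
        obtain ⟨x, hx⟩ := Z'.2.nonempty
        refine lt_of_le_of_ne (fun F hF => ?_) fun h => ?_
        · simpa using hF x hx 0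
        · obtain ⟨i, hi⟩ := Function.ne_iff.mp x.rep_nonzero
          have h1 : (MvPolynomial.X i : MvPolynomial ι ℂ) ∈ coneIdeal (Z' : Set (ℙ ℂ (ι → ℂ))) := by
            rw [h]
            simp
          have h2 := h1 x hx 1
          simp only [one_smul, MvPolynomial.eval_X] at h2
          exact hi h2
      | coe Z =>
        rw [WithBot.coe_lt_coe] at hab
        change coneIdeal (Z' : Set (ℙ ℂ (ι → ℂ))) < coneIdeal (Z : Set (ℙ ℂ (ι → ℂ)))
        refine lt_of_le_not_ge (coneIdeal_anti hab.le) fun h => ?_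
        exact hab.not_ge (subset_of_coneIdeal_le Z.3 h)
  have h := Order.krullDim_le_of_strictMono f hf
  rw [Order.krullDim_withBot, Order.krullDim_orderDual] at h
  refine h.trans ?_
  change ringKrullDim (MvPolynomial ι ℂ) ≤ _
  rw [MvPolynomial.ringKrullDim_of_isNoetherianRing, ringKrullDim_eq_zero_of_field]
  simp

open TopologicalSpace in
-- The full flag of coordinate subspaces is a chain of length `d`.
theorem le_topologicalKrullDim (d : ℕ) :
    (d : WithBot ℕ∞) ≤ topologicalKrullDim (ℙ ℂ (Fin (d + 1) → ℂ)) := by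
  let Λ (i : Fin (d + 1)) : (Fin (d + 1) → ℂ) →ₗ[ℂ] (Fin (d + 1) → ℂ) :=
    LinearMap.pi fun j => if i < j then LinearMap.proj j else 0
  have hΛ : ∀ i v, v ∈ LinearMap.ker (Λ i) ↔ ∀ j, i < j → v j = 0 := by
    intro i v
    rw [LinearMap.mem_ker, funext_iff]
    refine forall_congr' fun j => ?_
    by_cases h : i < j <;> simp [Λ, h]
  have hsingle : ∀ i, Pi.single i (1 : ℂ) ∈ LinearMap.ker (Λ i) := fun i => by
    rw [hΛ]
    intro j hj
    exact Pi.single_eq_of_ne hj.ne' _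
  have hne : ∀ i : Fin (d + 1), (Pi.single i (1 : ℂ) : Fin (d + 1) → ℂ) ≠ 0 := fun i h => by
    simpa using congrFun h i
  let Z (i : Fin (d + 1)) : IrreducibleCloseds (ℙ ℂ (Fin (d + 1) → ℂ)) :=
    ⟨{x | x.rep ∈ LinearMap.ker (Λ i)},
      isIrreducible_rep_mem fun h => hne i (by simpa [h] using hsingle i),
      isClosed_rep_mem_ker _⟩
  have hZ : StrictMono Z := by
    intro i j hij
    refine lt_of_le_not_ge (fun x hx => ?_) fun h => ?_
    · exact (hΛ j _).mpr fun k hk => (hΛ i _).mp hx k (hij.trans hk)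
    · have h1 := h ((rep_mk_mem_iff (LinearMap.ker (Λ j)) _ (hne j)).mpr (hsingle j))
      have h2 := (rep_mk_mem_iff (LinearMap.ker (Λ i)) _ (hne j)).mp h1
      simpa using (hΛ i _).mp h2 j hij
  exact le_iSup_of_le (LTSeries.mk d Z hZ) le_rfl

theorem topologicalKrullDim_projectivization (d : ℕ) :
    topologicalKrullDim (ℙ ℂ (Fin (d + 1) → ℂ)) = d := by
  refine le_antisymm ?_ (le_topologicalKrullDim d)
  have h := topologicalKrullDim_add_one_le (ι := Fin (d + 1))
  rw [Fintype.card_fin] at h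
  generalize topologicalKrullDim (ℙ ℂ (Fin (d + 1) → ℂ)) = a at h ⊢
  induction a using WithBot.recBotCoe with
  | bot => exact bot_le
  | coe a =>
    induction a using ENat.recTopCoe with
    | top =>
      have h' : (⊤ : ℕ∞) + 1 ≤ ((d + 1 : ℕ) : ℕ∞) := WithBot.coe_le_coe.mp h
      rw [top_add, top_le_iff] at h'
      exact absurd h' (ENat.natCast_ne_top _)
    | coe a =>
      norm_cast at h ⊢
      omega

theorem topologicalKrullDim_le_of_range_subset {X Y Z : Type*} [TopologicalSpace X]
    [TopologicalSpace Y] [TopologicalSpace Z] {f : X → Z} {g : Y → Z} (hf : Topology.IsInducing f)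
    (hg : Topology.IsInducing g) (h : Set.range f ⊆ Set.range g) :
    topologicalKrullDim X ≤ topologicalKrullDim Y := by
  choose u hu using fun x => h ⟨x, rfl⟩
  have hgu : g ∘ u = f := funext hu
  have : Topology.IsInducing u := by
    rw [← hg.of_comp_iff, hgu]
    exact hf
  exact this.topologicalKrullDim_le

end Dimension

/-! ### Maps given locally by homogeneous polynomials -/

section LocallyPolynomial

variable {ι κ : Type} {X : Set (ℙ ℂ (ι → ℂ))} {φ : X → ℙ ℂ (κ → ℂ)}

/-- Near each point of `X`, the homogeneous coordinates of `φ` are homogeneous polynomials of the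
same degree. -/
def IsLocallyPolynomial (φ : X → ℙ ℂ (κ → ℂ)) : Prop :=
  ∀ x : X, ∃ (d : ℕ) (H : κ → MvPolynomial ι ℂ), (∀ k, (H k).IsHomogeneous d) ∧
    ∀ᶠ y : X in nhds x, ∃ c : ℂ, c ≠ 0 ∧
      (fun k => MvPolynomial.eval y.1.rep (H k)) = c • (φ y).rep

theorem IsLocallyPolynomial.continuous (hφ : IsLocallyPolynomial φ) : Continuous φ := by
  rw [continuous_generateFrom_iff]
  rintro _ ⟨F, e, hF, rfl⟩
  rw [isOpen_iff_mem_nhds]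
  intro x hx
  obtain ⟨d, H, hH, hev⟩ := hφ x
  have key : ∀ y : X, (∃ c : ℂ, c ≠ 0 ∧
      (fun k => MvPolynomial.eval y.1.rep (H k)) = c • (φ y).rep) →
      (MvPolynomial.eval y.1.rep (MvPolynomial.aeval H F) ≠ 0 ↔
        MvPolynomial.eval (φ y).rep F ≠ 0) := by
    rintro y ⟨c, hc, h⟩
    rw [eval_aeval, h, eval_smul_of_isHomogeneous hF]
    simp [hc]
  have hopen : IsOpen {y : X | MvPolynomial.eval y.1.rep (MvPolynomial.aeval H F) ≠ 0} :=
    (isOpen_ne_zero (hF.aeval H hH)).preimage continuous_subtype_val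
  filter_upwards [hev, hopen.mem_nhds ((key x hev.self_of_nhds).mpr hx)] with y hy hy'
  exact (key y hy).mp hy'

theorem IsLocallyPolynomial.isRegularAt (hφ : IsLocallyPolynomial φ) {x : X} {h : X → ℂ}
    (hh : IsPullbackGerm φ h x) : IsRegularAt h x := by
  obtain ⟨e, F, G, hF, hG, hGx, hFG⟩ := hh
  obtain ⟨d, H, hH, hev⟩ := hφ x
  have key : ∀ P : MvPolynomial κ ℂ, P.IsHomogeneous e → ∀ (y : X) (c : ℂ),
      (fun k => MvPolynomial.eval y.1.rep (H k)) = c • (φ y).rep →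
      MvPolynomial.eval y.1.rep (MvPolynomial.aeval H P) =
        c ^ e * MvPolynomial.eval (φ y).rep P := by
    intro P hP y c h
    rw [eval_aeval, h, eval_smul_of_isHomogeneous hP]
  refine ⟨d * e, MvPolynomial.aeval H F, MvPolynomial.aeval H G, hF.aeval H hH, hG.aeval H hH,
    ?_, ?_⟩
  · obtain ⟨c, hc, h⟩ := hev.self_of_nhds
    change MvPolynomial.eval x.1.rep _ ≠ 0
    rw [key G hG x c h]
    exact mul_ne_zero (pow_ne_zero _ hc) hGx
  · filter_upwards [hev, hFG] with y ⟨c, hc, h⟩ hy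
    rw [hy, ratio, ratio, key F hF y c h, key G hG y c h, mul_div_mul_left _ _ (pow_ne_zero _ hc)]

theorem IsLocallyPolynomial.isMorphism (hφ : IsLocallyPolynomial φ) : IsMorphism X φ :=
  ⟨hφ.continuous, fun _ _ => hφ.isRegularAt⟩

end LocallyPolynomial

/-! ### Kernels of matrices of corank one vary polynomially. -/

section Kernels

variable {ι J κ : Type} [Fintype ι] [Fintype J] [Fintype κ]

omit [Fintype ι] in
theorem isHomogeneous_det {k d : ℕ} (N : Matrix (Fin k) (Fin k) (MvPolynomial ι ℂ))
    (hN : ∀ i j, (N i j).IsHomogeneous d) : N.det.IsHomogeneous (k * d) := by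
  rw [Matrix.det_apply]
  refine MvPolynomial.IsHomogeneous.sum _ _ _ fun σ _ => ?_
  have h : (∏ i, N (σ i) i).IsHomogeneous (∑ _i : Fin k, d) :=
    MvPolynomial.IsHomogeneous.prod _ _ _ fun i _ => hN _ _
  rw [Finset.sum_const, Finset.card_univ, Fintype.card_fin, smul_eq_mul] at h
  rcases Int.units_eq_one_or (Equiv.Perm.sign σ) with hs | hs
  · rwa [hs, one_smul]
  · rw [hs, Units.neg_smul, one_smul]
    exact h.neg

/-- The entries of the contraction of a tensor with a vector, as linear forms. -/
def contractForm (T : ι × J × κ → ℂ) (j : J) (k : κ) : MvPolynomial ι ℂ :=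
  ∑ i, MvPolynomial.C (T (i, j, k)) * MvPolynomial.X i

omit [Fintype J] [Fintype κ] in
theorem eval_contractForm (T : ι × J × κ → ℂ) (j : J) (k : κ) (v : ι → ℂ) :
    MvPolynomial.eval v (contractForm T j k) = contract T v j k := by
  simp [contractForm, contract]

omit [Fintype J] [Fintype κ] in
theorem isHomogeneous_contractForm (T : ι × J × κ → ℂ) (j : J) (k : κ) :
    (contractForm T j k).IsHomogeneous 1 :=
  MvPolynomial.IsHomogeneous.sum _ _ _ fun i _ => by
    simpa using (MvPolynomial.isHomogeneous_X ℂ i).C_mul (T (i, j, k))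

omit [Fintype J] in
theorem exists_smul_of_mulVec_eq_zero {A : Matrix J κ ℂ} (hA : Fintype.card κ ≤ A.rank + 1)
    {v w : κ → ℂ} (hv : v ≠ 0) (hAv : A.mulVec v = 0) (hAw : A.mulVec w = 0) :
    ∃ c : ℂ, w = c • v := by
  have h1 := A.mulVecLin.finrank_range_add_finrank_ker
  rw [Module.finrank_fintype_fun_eq_card] at h1
  have h2 : Module.finrank ℂ (LinearMap.ker A.mulVecLin) ≤ 1 := by
    unfold Matrix.rank at hA
    omega
  have hv' : (⟨v, hAv⟩ : LinearMap.ker A.mulVecLin) ≠ 0 := fun h => hv (congrArg Subtype.val h)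
  have h3 : Module.finrank ℂ (LinearMap.ker A.mulVecLin) = 1 :=
    le_antisymm h2 (Module.finrank_pos_iff_exists_ne_zero.mpr ⟨_, hv'⟩)
  obtain ⟨c, hc⟩ := (finrank_eq_one_iff_of_nonzero' _ hv').mp h3 ⟨w, hAw⟩
  exact ⟨c, (congrArg Subtype.val hc).symm⟩

omit [Fintype J] in
theorem eq_of_mulVec_rep_eq_zero {A : Matrix J κ ℂ} (hA : Fintype.card κ ≤ A.rank + 1)
    {x y : ℙ ℂ (κ → ℂ)} (hx : A.mulVec x.rep = 0) (hy : A.mulVec y.rep = 0) : x = y := by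
  obtain ⟨c, hc⟩ := exists_smul_of_mulVec_eq_zero hA y.rep_nonzero hy hx
  rw [← x.mk_rep, ← y.mk_rep, Projectivization.mk_eq_mk_iff']
  exact ⟨c, hc.symm⟩

/-- By Cramer's rule, the signed maximal minors of independent rows chosen at `x` span the kernel
there. At every `y` in `X` they still give a kernel vector, since all minors of full width vanish,
and this vector stays nonzero near `x`. -/
theorem isLocallyPolynomial_of_mulVec_eq_zero (T : ι × J × κ → ℂ) {X : Set (ℙ ℂ (ι → ℂ))}
    {φ : X → ℙ ℂ (κ → ℂ)} (hφ : ∀ x : X, (contract T x.1.rep).mulVec (φ x).rep = 0)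
    (hrk : ∀ x : X, Fintype.card κ ≤ (contract T x.1.rep).rank + 1) : IsLocallyPolynomial φ := by
  intro x
  have hlt : ∀ y : X, (contract T y.1.rep).rank < Fintype.card κ := by
    intro y
    have h1 := (contract T y.1.rep).mulVecLin.finrank_range_add_finrank_ker
    rw [Module.finrank_fintype_fun_eq_card] at h1
    have h2 : 0 < Module.finrank ℂ (LinearMap.ker (contract T y.1.rep).mulVecLin) :=
      Module.finrank_pos_iff_exists_ne_zero.mpr
        ⟨⟨(φ y).rep, hφ y⟩, fun h => (φ y).rep_nonzero (congrArg Subtype.val h)⟩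
    unfold Matrix.rank
    omega
  obtain ⟨k, hk⟩ : ∃ k, Fintype.card κ = k + 1 := ⟨Fintype.card κ - 1, by have := hlt x; omega⟩
  let e : Fin (k + 1) ≃ κ := (Fintype.equivFinOfCardEq hk).symm
  obtain ⟨f, -, hf⟩ := exists_linearIndependent_rows (contract T x.1.rep) (k := k)
    (by have := hrk x; omega)
  let H (l : κ) : MvPolynomial ι ℂ := (-1) ^ (e.symm l : ℕ) *
    (Matrix.of fun a b => contractForm T (f a) (e ((e.symm l).succAbove b))).det
  have hH : ∀ l, (H l).IsHomogeneous k := by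
    intro l
    have h1 := isHomogeneous_det
      (Matrix.of fun a b => contractForm T (f a) (e ((e.symm l).succAbove b)))
      fun i j => isHomogeneous_contractForm T _ _
    have h2 := ((MvPolynomial.isHomogeneous_one ι ℂ).neg.pow (e.symm l : ℕ)).mul h1
    simpa using h2
  -- pairing with the vector of minors is a determinant
  have hdet : ∀ (v : ι → ℂ) (w : κ → ℂ),
      ∑ l, w l * MvPolynomial.eval v (H l) = (Matrix.of (Fin.cons (fun b => w (e b))
        fun a b => contract T v (f a) (e b)) : Matrix (Fin (k + 1)) (Fin (k + 1)) ℂ).det := by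
    intro v w
    rw [Matrix.det_succ_row_zero, ← e.sum_comp]
    refine Finset.sum_congr rfl fun b _ => ?_
    simp only [H, map_mul, RingHom.map_det, map_pow, map_neg, map_one, e.symm_apply_apply]
    rw [mul_left_comm, ← mul_assoc]
    congr 2
    ext a b'
    simp [eval_contractForm]
  have hker : ∀ y : X, (contract T y.1.rep).mulVec (fun l => MvPolynomial.eval y.1.rep (H l)) = 0 := by
    intro y
    funext j
    change ∑ l, contract T y.1.rep j l * MvPolynomial.eval y.1.rep (H l) = 0
    rw [hdet, ← minor_eq_zero (contract T y.1.rep) (k := k + 1) (by rw [← hk]; exact hlt y)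
      (Fin.cons j f) e]
    congr 1
    ext a b
    refine Fin.cases ?_ (fun a => ?_) a <;> simp
  -- A vector outside the span of the chosen rows completes them to an invertible matrix, so its
  -- pairing with the vector of minors is nonzero.
  have hne : ∃ l, MvPolynomial.eval x.1.rep (H l) ≠ 0 := by
    by_contra! hcon
    let rows : Fin k → κ → ℂ := fun a => (contract T x.1.rep).row (f a)
    obtain ⟨w, hw⟩ : ∃ w, w ∉ Submodule.span ℂ (Set.range rows) := by
      by_contra! hall
      have h1 := finrank_span_eq_card hf
      rw [Submodule.eq_top_iff'.mpr hall, finrank_top, Module.finrank_fintype_fun_eq_card,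
        Fintype.card_fin] at h1
      omega
    have hli : LinearIndependent ℂ (Fin.cons w rows : Fin (k + 1) → κ → ℂ) :=
      linearIndependent_finCons.mpr ⟨hf, hw⟩
    have hli' := hli.map' (LinearEquiv.funCongrLeft ℂ ℂ e).toLinearMap (LinearEquiv.ker _)
    have h2 : (⇑(LinearEquiv.funCongrLeft ℂ ℂ e).toLinearMap ∘
        (Fin.cons w rows : Fin (k + 1) → κ → ℂ)) =
        (Matrix.of (Fin.cons (fun b => w (e b)) fun a b => contract T x.1.rep (f a) (e b)) :
          Matrix (Fin (k + 1)) (Fin (k + 1)) ℂ).row := by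
      funext a b
      refine Fin.cases ?_ (fun a => ?_) a <;> rfl
    rw [h2, Matrix.linearIndependent_rows_iff_isUnit, Matrix.isUnit_iff_isUnit_det] at hli'
    apply hli'.ne_zero
    rw [← hdet]
    simp [hcon]
  obtain ⟨l, hl⟩ := hne
  refine ⟨k, H, hH, ?_⟩
  have hopen : IsOpen {y : X | MvPolynomial.eval y.1.rep (H l) ≠ 0} :=
    (isOpen_ne_zero (hH l)).preimage continuous_subtype_val
  filter_upwards [hopen.mem_nhds hl] with y hy
  obtain ⟨c, hc⟩ := exists_smul_of_mulVec_eq_zero (hrk y) (φ y).rep_nonzero (hφ y) (hker y)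
  refine ⟨c, ?_, hc⟩
  rintro rfl
  apply hy
  have := congrFun hc l
  simpa using this

end Kernels

section ClosedImmersion

variable {ι κ : Type} {X : Set (ℙ ℂ (ι → ℂ))} {φ : X → ℙ ℂ (κ → ℂ)}

/-- A locally polynomial inverse on the image carries regular germs on `X` to regular germs on the
image, which is surjectivity on stalks; its continuity makes `φ` a homeomorphism onto the image. -/
theorem IsLocallyPolynomial.isClosedImmersion (hφ : IsLocallyPolynomial φ)
    (hclosed : IsClosed (Set.range φ)) (χ : Set.range φ → X)
    (hχφ : ∀ x, χ ⟨φ x, x, rfl⟩ = x) (hχ : IsLocallyPolynomial fun z => (χ z : ℙ ℂ (ι → ℂ))) :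
    IsClosedImmersion X φ := by
  have hcont : Continuous χ := hχ.continuous.subtype_mk fun z => (χ z).2
  let f : X → Set.range φ := fun x => ⟨φ x, x, rfl⟩
  have hf : Continuous f := hφ.continuous.subtype_mk _
  have hχf : (fun z => (χ z : ℙ ℂ (ι → ℂ))) ∘ f = Subtype.val := by
    funext x
    exact congrArg Subtype.val (hχφ x)
  have hind : Topology.IsInducing f := Topology.IsInducing.of_comp hf hχ.continuous (by
    rw [hχf]
    exact Topology.IsInducing.subtypeVal)
  refine { hφ.isMorphism with
    isClosedEmbedding := ⟨⟨Topology.IsInducing.subtypeVal.comp hind, fun x y hxy => ?_⟩, hclosed⟩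
    surjective_on_stalks := ?_ }
  · rw [← hχφ x, ← hχφ y]
    exact congrArg χ (Subtype.ext hxy)
  · rintro x h ⟨d, F, G, hF, hG, hGx, hev⟩
    have hpull : IsPullbackGerm (fun z => (χ z : ℙ ℂ (ι → ℂ))) (fun z => h (χ z)) (f x) := by
      refine ⟨d, F, G, hF, hG, ?_, ?_⟩
      · simpa [f, hχφ] using hGx
      · have ht : Filter.Tendsto χ (nhds (f x)) (nhds x) := by
          have := hcont.tendsto (f x)
          rwa [hχφ x] at this
        exact ht.eventually hev
    obtain ⟨e, F', G', hF', hG', hGx', hev'⟩ := hχ.isRegularAt hpull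
    refine ⟨e, F', G', hF', hG', hGx', ?_⟩
    filter_upwards [(hf.tendsto x).eventually hev'] with y hy
    rw [← hy]
    exact congrArg h (hχφ y).symm

end ClosedImmersion

section RankLoci

variable {ι J κ : Type} [Fintype ι] [Fintype J] [Fintype κ]

theorem isOpen_le_rank_contract (T : ι × J × κ → ℂ) (k : ℕ) :
    IsOpen {x : ℙ ℂ (ι → ℂ) | k ≤ (contract T x.rep).rank} := by
  have h : {x : ℙ ℂ (ι → ℂ) | k ≤ (contract T x.rep).rank} =
      ⋃ (f : Fin k → J) (g : Fin k → κ), {x | MvPolynomial.eval x.rep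
        (Matrix.of fun a b => contractForm T (f a) (g b)).det ≠ 0} := by
    ext x
    have hdet : ∀ (f : Fin k → J) (g : Fin k → κ), MvPolynomial.eval x.rep
        (Matrix.of fun a b => contractForm T (f a) (g b)).det =
          ((contract T x.rep).submatrix f g).det := by
      intro f g
      rw [RingHom.map_det]
      congr 1
      ext a b
      simp [eval_contractForm]
    simp only [Set.mem_iUnion, Set.mem_ofPred_eq, hdet]
    constructor
    · intro hk
      obtain ⟨f, g, -, -, h⟩ := exists_minor_ne_zero _ hk
      exact ⟨f, g, h⟩
    · rintro ⟨f, g, h⟩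
      by_contra! hk
      exact h (minor_eq_zero _ hk f g)
  rw [h]
  exact isOpen_iUnion fun f => isOpen_iUnion fun g =>
    isOpen_ne_zero (isHomogeneous_det _ fun a b => isHomogeneous_contractForm T (f a) (g b))

end RankLoci

theorem eq_zero_of_rank_eq_zero {J κ : Type} [Fintype κ] {A : Matrix J κ ℂ} (hA : A.rank = 0) :
    A = 0 := by
  ext j k
  have h := minor_eq_zero A (k := 1) (by omega) (fun _ => j) (fun _ => k)
  simpa using h

/-! ### The degeneracy locus of a matrix of linear forms -/

section Locus

variable {n m s : ℕ}

theorem coeffMatrix_eq_contract (M : LinMatrix n m s) (a : Fin n → ℂ) :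
    coeffMatrix M a = contract M a := rfl

/-- The coefficients of the transpose of `M`, with the variables of the linear forms first. -/
def flipTensor (M : LinMatrix n m s) : Fin (s + 1) × Fin (n + m) × Fin n → ℂ :=
  fun x => M (x.2.2, x.2.1, x.1)

theorem contract_flipTensor (M : LinMatrix n m s) (v : Fin (s + 1) → ℂ) :
    contract (flipTensor M) v = (evalAt M v).transpose := rfl

/-- Rank at most `n - 2` has codimension `2(m + 2)` among the matrices of this size, and `s + 1 ≤ 2m
+ 4`. -/
theorem forGeneral_le_rank_evalAt (hn : 2 ≤ n) (hs : s ≤ 2 * m + 3) :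
    ForGeneral fun M : LinMatrix n m s => ∀ v, v ≠ 0 → n ≤ (evalAt M v).rank + 1 := by
  have h := forGeneral_lt_rank_contract (I := Fin (s + 1)) (J := Fin (n + m)) (K := Fin n)
    Finset.univ (n - 2) (by simp only [Fintype.card_fin]; omega)
    (by simp only [Fintype.card_fin]; omega) (by
      simp only [Finset.card_univ, Fintype.card_fin]
      rw [show n + m - (n - 2) = m + 2 by omega, show n - (n - 2) = 2 by omega]
      omega)
  let e : Fin (s + 1) × Fin (n + m) × Fin n ≃ Fin n × Fin (n + m) × Fin (s + 1) :=
    { toFun := fun x => (x.2.2, x.2.1, x.1)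
      invFun := fun x => (x.2.2, x.2.1, x.1)
      left_inv := fun _ => rfl
      right_inv := fun _ => rfl }
  refine (h.comp_equiv e).mono fun M hM v hv => ?_
  have h1 := hM v hv (by simp)
  have h2 : contract (M ∘ e) v = (evalAt M v).transpose := rfl
  rw [h2, Matrix.rank_transpose] at h1
  omega

theorem forGeneral_lt_rank_coeffMatrix {k : ℕ} (hp : k ≤ n + m) (hq : k ≤ s + 1)
    (h : n ≤ (n + m - k) * (s + 1 - k)) :
    ForGeneral fun M : LinMatrix n m s => ∀ a, a ≠ 0 → k < (coeffMatrix M a).rank :=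
  (forGeneral_lt_rank_contract (I := Fin n) (J := Fin (n + m)) (K := Fin (s + 1))
    Finset.univ k (by simpa using hp) (by simpa using hq) (by simpa using h)).mono
    fun M hM a ha => hM a ha (by simp)

/-- To get rank exactly `k`, restrict to a coordinate subspace whose dimension is the codimension
plus one. Rank at most `k` is forced to occur there, while rank at most `k - 1` has codimension `(p
- k + 1)(q - k + 1)`, large enough to be avoided. -/
theorem forGeneral_exists_rank_coeffMatrix_eq {k : ℕ} (hk : 1 ≤ k) (hp : k ≤ n + m)
    (hq : k ≤ s + 1) (h : (n + m - k) * (s + 1 - k) < n) :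
    ForGeneral fun M : LinMatrix n m s =>
      ∃ a : ℙ ℂ (Fin n → ℂ), (coeffMatrix M a.rep).rank = k := by
  obtain ⟨S, -, hS⟩ := Finset.exists_subset_card_eq
    (s := (Finset.univ : Finset (Fin n))) (n := (n + m - k) * (s + 1 - k) + 1) (by simpa using h)
  have hgen := forGeneral_lt_rank_contract (I := Fin n) (J := Fin (n + m)) (K := Fin (s + 1))
    S (k - 1) (by rw [Fintype.card_fin]; omega) (by rw [Fintype.card_fin]; omega) (by
      rw [hS, Fintype.card_fin, Fintype.card_fin]
      rw [show n + m - (k - 1) = n + m - k + 1 by omega, show s + 1 - (k - 1) = s + 1 - k + 1 by omega]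
      nlinarith)
  refine hgen.mono fun M hM => ?_
  obtain ⟨a, ha, haS, hrk⟩ := exists_rank_contract_le (J := Fin (n + m)) (K := Fin (s + 1)) M S
    (k := k) (by simpa using hp) (by simpa using hq) (by simp [hS])
  have h1 := hM a ha haS
  obtain ⟨c, hc⟩ := Projectivization.exists_smul_eq_mk_rep ℂ a ha
  refine ⟨Projectivization.mk ℂ a ha, ?_⟩
  rw [← hc, Units.smul_def, map_smul, Matrix.rank_smul_of_mem_nonZeroDivisors _
    (mem_nonZeroDivisors_of_ne_zero c.ne_zero), coeffMatrix_eq_contract]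
  omega

theorem mulVec_rep_psi (M : LinMatrix n m s) (x : locus M) :
    (evalAt M x.1.rep).transpose.mulVec (psi M x).rep = 0 :=
  (exists_kernel M x).choose_spec

theorem mem_locus_of_mulVec_eq_zero (M : LinMatrix n m s) {x : ℙ ℂ (Fin (s + 1) → ℂ)}
    {a : Fin n → ℂ} (ha : a ≠ 0) (h : (coeffMatrix M a).mulVec x.rep = 0) : x ∈ locus M := by
  rw [coeffMatrix_mulVec] at h
  have h1 := (evalAt M x.rep).transpose.mulVecLin.finrank_range_add_finrank_ker
  rw [Module.finrank_fin_fun] at h1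
  have h2 : 0 < Module.finrank ℂ (LinearMap.ker (evalAt M x.rep).transpose.mulVecLin) :=
    Module.finrank_pos_iff_exists_ne_zero.mpr ⟨⟨a, h⟩, fun h => ha (congrArg Subtype.val h)⟩
  change (evalAt M x.rep).rank < n
  rw [← Matrix.rank_transpose]
  unfold Matrix.rank
  omega

variable {M : LinMatrix n m s} (hM : ∀ v, v ≠ 0 → n ≤ (evalAt M v).rank + 1)

include hM in
theorem psi_eq_iff (x : locus M) (a : ℙ ℂ (Fin n → ℂ)) :
    psi M x = a ↔ (evalAt M x.1.rep).transpose.mulVec a.rep = 0 := by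
  refine ⟨fun h => h ▸ mulVec_rep_psi M x, fun h => ?_⟩
  refine eq_of_mulVec_rep_eq_zero ?_ (mulVec_rep_psi M x) h
  rw [Fintype.card_fin, Matrix.rank_transpose]
  exact hM _ x.1.rep_nonzero

include hM in
theorem psi_eq_iff_coeffMatrix (x : locus M) (a : ℙ ℂ (Fin n → ℂ)) :
    psi M x = a ↔ (coeffMatrix M a.rep).mulVec x.1.rep = 0 := by
  rw [psi_eq_iff hM, coeffMatrix_mulVec]

include hM in
theorem isLocallyPolynomial_psi : IsLocallyPolynomial (psi M) := by
  refine isLocallyPolynomial_of_mulVec_eq_zero (flipTensor M) (fun x => mulVec_rep_psi M x)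
    fun x => ?_
  rw [contract_flipTensor, Matrix.rank_transpose, Fintype.card_fin]
  exact hM _ x.1.rep_nonzero

theorem exists_mulVec_eq_zero_of_rank_le {p q : ℕ} {A : Matrix (Fin p) (Fin (q + 1)) ℂ}
    (hA : A.rank ≤ q) : ∃ x : ℙ ℂ (Fin (q + 1) → ℂ), A.mulVec x.rep = 0 := by
  have h1 := A.mulVecLin.finrank_range_add_finrank_ker
  rw [Module.finrank_fin_fun] at h1
  have h2 : 0 < Module.finrank ℂ (LinearMap.ker A.mulVecLin) := by
    unfold Matrix.rank at hA
    omega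
  obtain ⟨⟨v, hv⟩, hv0⟩ := Module.finrank_pos_iff_exists_ne_zero.mp h2
  have hv0' : v ≠ 0 := fun h => hv0 (Subtype.ext h)
  exact ⟨Projectivization.mk ℂ v hv0', (rep_mk_mem_iff (LinearMap.ker A.mulVecLin) v hv0').mpr hv⟩

theorem rank_lt_of_mulVec_eq_zero {p q : ℕ} {A : Matrix (Fin p) (Fin q) ℂ} {v : Fin q → ℂ}
    (hv : v ≠ 0) (h : A.mulVec v = 0) : A.rank < q := by
  have h1 := A.mulVecLin.finrank_range_add_finrank_ker
  rw [Module.finrank_fin_fun] at h1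
  have h2 : 0 < Module.finrank ℂ (LinearMap.ker A.mulVecLin) :=
    Module.finrank_pos_iff_exists_ne_zero.mpr ⟨⟨v, h⟩, fun h => hv (congrArg Subtype.val h)⟩
  unfold Matrix.rank
  omega

include hM in
theorem mem_range_psi_iff (a : ℙ ℂ (Fin n → ℂ)) :
    a ∈ Set.range (psi M) ↔ (coeffMatrix M a.rep).rank ≤ s := by
  constructor
  · rintro ⟨x, hx⟩
    rw [psi_eq_iff_coeffMatrix hM] at hx
    exact Nat.lt_succ_iff.mp (rank_lt_of_mulVec_eq_zero x.1.rep_nonzero hx)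
  · intro h
    obtain ⟨x, hx⟩ := exists_mulVec_eq_zero_of_rank_le h
    exact ⟨⟨x, mem_locus_of_mulVec_eq_zero M a.rep_nonzero hx⟩, (psi_eq_iff_coeffMatrix hM _ _).mpr hx⟩

include hM in
-- On the image of `psi M` the rank of `A_α` is exactly `s`, so its kernel is a line and gives the
-- inverse map. The image is closed because it is the locus of rank at most `s`.
theorem isClosedImmersion_psi (hA : ∀ a, a ≠ 0 → s ≤ (coeffMatrix M a).rank) :
    IsClosedImmersion (locus M) (psi M) := by
  have hinj : Function.Injective (psi M) := by
    intro x y hxy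
    have hx := (psi_eq_iff_coeffMatrix hM x (psi M y)).mp hxy
    have hy := (psi_eq_iff_coeffMatrix hM y (psi M y)).mp rfl
    refine Subtype.ext (eq_of_mulVec_rep_eq_zero ?_ hx hy)
    rw [Fintype.card_fin]
    exact Nat.succ_le_succ (hA _ (psi M y).rep_nonzero)
  let χ : Set.range (psi M) → locus M := fun z => z.2.choose
  have hχ : ∀ z, psi M (χ z) = z.1 := fun z => z.2.choose_spec
  refine (isLocallyPolynomial_psi hM).isClosedImmersion ?_ χ (fun x => hinj (hχ _)) ?_
  · have h : Set.range (psi M) = {a | s + 1 ≤ (contract M a.rep).rank}ᶜ := by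
      ext a
      rw [mem_range_psi_iff hM]
      simp [coeffMatrix_eq_contract]
    rw [h]
    exact (isOpen_le_rank_contract M (s + 1)).isClosed_compl
  · refine isLocallyPolynomial_of_mulVec_eq_zero M (fun z => ?_) fun z => ?_
    · exact (psi_eq_iff_coeffMatrix hM _ _).mp (hχ z)
    · rw [Fintype.card_fin]
      exact Nat.succ_le_succ (hA _ z.1.rep_nonzero)

include hM in
-- The kernel of `A_a` has dimension at least two, and `psi M` takes the value `a` at all its
-- points.
theorem not_injective_psi_of_rank_lt {a : ℙ ℂ (Fin n → ℂ)}
    (ha : (coeffMatrix M a.rep).rank < s) : ¬ Function.Injective (psi M) := by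
  intro hinj
  let V := LinearMap.ker (coeffMatrix M a.rep).mulVecLin
  have h1 := (coeffMatrix M a.rep).mulVecLin.finrank_range_add_finrank_ker
  rw [Module.finrank_fin_fun] at h1
  have h2 : 1 < Module.finrank ℂ V := by
    unfold Matrix.rank at ha
    change _ + Module.finrank ℂ V = _ at h1
    omega
  have h3 : 0 < Module.finrank ℂ V := by omega
  obtain ⟨v, hv⟩ := Module.finrank_pos_iff_exists_ne_zero.mp h3
  have hv0 : (v : Fin (s + 1) → ℂ) ≠ 0 := fun h => hv (Subtype.ext h)
  have hpt : ∀ (w : V) (hw : (w : Fin (s + 1) → ℂ) ≠ 0),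
      ∃ x : locus M, x.1 = Projectivization.mk ℂ (w : Fin (s + 1) → ℂ) hw ∧ psi M x = a := by
    intro w hw
    have hmem := (rep_mk_mem_iff V _ hw).mpr w.2
    exact ⟨⟨_, mem_locus_of_mulVec_eq_zero M a.rep_nonzero hmem⟩, rfl,
      (psi_eq_iff_coeffMatrix hM _ _).mpr hmem⟩
  have h4 : Module.finrank ℂ V ≤ 1 := by
    refine finrank_le_one v fun w => ?_
    by_cases hw : (w : Fin (s + 1) → ℂ) = 0
    · exact ⟨0, Subtype.ext (by simp [hw])⟩
    · obtain ⟨x, hx, hxa⟩ := hpt v hv0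
      obtain ⟨y, hy, hya⟩ := hpt w hw
      have hxy : x = y := hinj (hxa.trans hya.symm)
      rw [hxy, hy, Projectivization.mk_eq_mk_iff'] at hx
      obtain ⟨c, hc⟩ := hx
      exact ⟨c, Subtype.ext hc⟩
  omega

theorem embed_injective (hf : Function.Injective (coeffMatrix M)) :
    Function.Injective (embed M hf) :=
  Projectivization.map_injective _ hf

theorem rank_rep_embed (hf : Function.Injective (coeffMatrix M)) (a : ℙ ℂ (Fin n → ℂ)) :
    (embed M hf a).rep.rank = (coeffMatrix M a.rep).rank := by
  obtain ⟨c, hc⟩ := Projectivization.exists_smul_eq_mk_rep ℂ (coeffMatrix M a.rep)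
    ((map_ne_zero_iff _ hf).mpr a.rep_nonzero)
  have h : embed M hf a = Projectivization.mk ℂ (coeffMatrix M a.rep)
      ((map_ne_zero_iff _ hf).mpr a.rep_nonzero) := by
    conv_lhs => rw [← a.mk_rep]
    rfl
  rw [h, ← hc, Units.smul_def, Matrix.rank_smul_of_mem_nonZeroDivisors _
    (mem_nonZeroDivisors_of_ne_zero c.ne_zero)]

theorem fpsi_preimage_embed (hf : Function.Injective (coeffMatrix M)) (a : ℙ ℂ (Fin n → ℂ)) :
    fpsi M hf ⁻¹' {embed M hf a} = {x | psi M x = a} := by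
  ext x
  exact (embed_injective hf).eq_iff

theorem fibreDim_of_notMem_range (hf : Function.Injective (coeffMatrix M))
    {y : ℙ ℂ (Matrix (Fin (n + m)) (Fin (s + 1)) ℂ)} (hy : y ∉ Set.range (fpsi M hf)) :
    fibreDim M hf y = ⊥ := by
  have h : IsEmpty ↑(fpsi M hf ⁻¹' {y}) := ⟨fun x => hy ⟨x.1, x.2⟩⟩
  have : IsEmpty (TopologicalSpace.IrreducibleCloseds ↑(fpsi M hf ⁻¹' {y})) :=
    ⟨fun Z => h.elim Z.2.nonempty.choose⟩
  exact Order.krullDim_eq_bot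

include hM in
-- The fibre and `ℙ^d` both carry the topology induced from `ℙ^s`, with the same image there: the
-- projective space of the kernel of `A_a`, which has dimension `d + 1` as a vector space.
theorem fibreDim_embed (hf : Function.Injective (coeffMatrix M)) (a : ℙ ℂ (Fin n → ℂ)) {d : ℕ}
    (ha : (coeffMatrix M a.rep).rank + d = s) : fibreDim M hf (embed M hf a) = d := by
  let V := LinearMap.ker (coeffMatrix M a.rep).mulVecLin
  have h1 := (coeffMatrix M a.rep).mulVecLin.finrank_range_add_finrank_ker
  rw [Module.finrank_fin_fun] at h1
  have h2 : Module.finrank ℂ V = d + 1 := by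
    unfold Matrix.rank at ha
    change _ + Module.finrank ℂ V = _ at h1
    omega
  let E : (Fin (d + 1) → ℂ) ≃ₗ[ℂ] V :=
    LinearEquiv.ofFinrankEq _ _ (by rw [Module.finrank_fin_fun, h2])
  let Λ : (Fin (d + 1) → ℂ) →ₗ[ℂ] (Fin (s + 1) → ℂ) := V.subtype ∘ₗ E.toLinearMap
  have hΛ : Function.Injective Λ := V.subtype_injective.comp E.injective
  have hrangeΛ : Set.range (Projectivization.map Λ hΛ) = {x | x.rep ∈ V} := by
    ext x
    constructor
    · rintro ⟨u, rfl⟩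
      induction u using Projectivization.ind with
      | h u hu =>
        rw [Projectivization.map_mk]
        exact (rep_mk_mem_iff V _ _).mpr (E u).2
    · intro hx
      have hx0 : E.symm ⟨x.rep, hx⟩ ≠ 0 := fun h =>
        x.rep_nonzero (congrArg Subtype.val ((LinearEquiv.map_eq_zero_iff _).mp h))
      refine ⟨Projectivization.mk ℂ _ hx0, ?_⟩
      rw [Projectivization.map_mk]
      conv_rhs => rw [← x.mk_rep]
      congr 1
      simp [Λ]
  let g : ↑(fpsi M hf ⁻¹' {embed M hf a}) → ℙ ℂ (Fin (s + 1) → ℂ) := fun x => x.1.1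
  have hg : Topology.IsInducing g :=
    Topology.IsInducing.subtypeVal.comp Topology.IsInducing.subtypeVal
  have hrangeg : Set.range g = {x | x.rep ∈ V} := by
    ext x
    constructor
    · rintro ⟨⟨x, hx⟩, rfl⟩
      rw [fpsi_preimage_embed] at hx
      exact (psi_eq_iff_coeffMatrix hM x a).mp hx
    · intro hx
      refine ⟨⟨⟨x, mem_locus_of_mulVec_eq_zero M a.rep_nonzero hx⟩, ?_⟩, rfl⟩
      rw [fpsi_preimage_embed]
      exact (psi_eq_iff_coeffMatrix hM _ a).mpr hx
  rw [← topologicalKrullDim_projectivization d]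
  exact le_antisymm
    (topologicalKrullDim_le_of_range_subset hg (isInducing_map Λ hΛ) (by rw [hrangeg, hrangeΛ]))
    (topologicalKrullDim_le_of_range_subset (isInducing_map Λ hΛ) hg (by rw [hrangeg, hrangeΛ]))

include hM in
theorem range_fpsi (hf : Function.Injective (coeffMatrix M)) :
    Set.range (fpsi M hf) = Set.range (embed M hf) ∩ rankStratum (n + m) (s + 1) s := by
  ext y
  constructor
  · rintro ⟨x, rfl⟩
    refine ⟨⟨psi M x, rfl⟩, ?_⟩
    change (embed M hf (psi M x)).rep.rank ≤ s
    rw [rank_rep_embed, ← mem_range_psi_iff hM]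
    exact ⟨x, rfl⟩
  · rintro ⟨⟨a, rfl⟩, ha⟩
    change (embed M hf a).rep.rank ≤ s at ha
    rw [rank_rep_embed, ← mem_range_psi_iff hM] at ha
    obtain ⟨x, rfl⟩ := ha
    exact ⟨x, rfl⟩

include hM in
theorem natCast_le_fibreDim_iff (hf : Function.Injective (coeffMatrix M)) {d : ℕ} (hd : d ≤ s)
    (y : ℙ ℂ (Matrix (Fin (n + m)) (Fin (s + 1)) ℂ)) :
    (d : WithBot ℕ∞) ≤ fibreDim M hf y ↔
      y ∈ Set.range (embed M hf) ∩ rankStratum (n + m) (s + 1) (s - d) := by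
  by_cases hy : y ∈ Set.range (fpsi M hf)
  · obtain ⟨x, rfl⟩ := hy
    have h1 := (mem_range_psi_iff hM (psi M x)).mp ⟨x, rfl⟩
    obtain ⟨e, he⟩ := Nat.exists_eq_add_of_le h1
    have h2 : fibreDim M hf (fpsi M hf x) = e := fibreDim_embed hM hf (psi M x) he.symm
    have h3 : (fpsi M hf x).rep.rank = (coeffMatrix M (psi M x).rep).rank := rank_rep_embed hf _
    rw [h2, Nat.cast_le, Set.mem_inter_iff, rankStratum, Set.mem_ofPred_eq, h3]
    refine ⟨fun h => ⟨⟨_, rfl⟩, by omega⟩, fun h => ?_⟩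
    have := h.2
    omega
  · rw [fibreDim_of_notMem_range hf hy]
    refine iff_of_false (by simp) fun h => hy ?_
    rw [range_fpsi hM]
    exact ⟨h.1, le_trans h.2 (Nat.sub_le _ _)⟩

include hM in
theorem fibreDim_eq_natCast_iff (hf : Function.Injective (coeffMatrix M)) {d : ℕ} (hd : d ≤ s)
    (y : ℙ ℂ (Matrix (Fin (n + m)) (Fin (s + 1)) ℂ)) :
    fibreDim M hf y = d ↔
      y ∈ Set.range (embed M hf) ∩ (rankStratum (n + m) (s + 1) (s - d) \
        rankStratum (n + m) (s + 1) (s - (d + 1))) := by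
  by_cases hy : y ∈ Set.range (fpsi M hf)
  · obtain ⟨x, rfl⟩ := hy
    have h1 := (mem_range_psi_iff hM (psi M x)).mp ⟨x, rfl⟩
    obtain ⟨e, he⟩ := Nat.exists_eq_add_of_le h1
    have h2 : fibreDim M hf (fpsi M hf x) = e := fibreDim_embed hM hf (psi M x) he.symm
    have h3 : (fpsi M hf x).rep.rank = (coeffMatrix M (psi M x).rep).rank := rank_rep_embed hf _
    -- For `d = s` the subtraction `s - (d + 1)` truncates to `0`. The stratum `N_0` is empty like
    -- `N_{-1}`, and no `A_α` has rank zero, so the equivalence survives. This covers `N_{s-3}` when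
    -- `s = 2`.
    have h4 : (coeffMatrix M (psi M x).rep).rank ≠ 0 := by
      intro h
      have h0 := eq_zero_of_rank_eq_zero h
      rw [map_eq_zero_iff _ hf] at h0
      exact (psi M x).rep_nonzero h0
    rw [h2, Nat.cast_inj, Set.mem_inter_iff, Set.mem_sdiff, rankStratum, rankStratum,
      Set.mem_ofPred_eq, Set.mem_ofPred_eq, h3]
    refine ⟨fun h => ⟨⟨_, rfl⟩, by omega, by omega⟩, fun h => ?_⟩
    have := h.2.1
    have := h.2.2
    omega
  · rw [fibreDim_of_notMem_range hf hy]
    refine iff_of_false (WithBot.bot_ne_coe) fun h => hy ?_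
    rw [range_fpsi hM]
    exact ⟨h.1, le_trans h.2.1 (Nat.sub_le _ _)⟩

end Locus

theorem injective_coeffMatrix {n m s : ℕ} {M : LinMatrix n m s}
    (h : ∀ a, a ≠ 0 → 0 < (coeffMatrix M a).rank) : Function.Injective (coeffMatrix M) := by
  rw [injective_iff_map_eq_zero]
  intro a ha
  by_contra h0
  have := h a h0
  rw [ha, Matrix.rank_zero] at this
  exact lt_irrefl _ this

theorem surjective_psi {n m s : ℕ} {M : LinMatrix n m s}
    (hM : ∀ v, v ≠ 0 → n ≤ (evalAt M v).rank + 1) (hs : n + m ≤ s) :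
    Function.Surjective (psi M) := fun a =>
  (mem_range_psi_iff hM a).mpr ((Matrix.rank_le_height _).trans hs)

theorem existsUnique_psi_eq {n m s : ℕ} {M : LinMatrix n m s}
    (hM : ∀ v, v ≠ 0 → n ≤ (evalAt M v).rank + 1) {a : ℙ ℂ (Fin n → ℂ)}
    (ha : (coeffMatrix M a.rep).rank = s) : ∃! x : locus M, psi M x = a := by
  obtain ⟨x, hx⟩ := (mem_range_psi_iff hM a).mpr ha.le
  refine ⟨x, hx, fun y hy => ?_⟩
  rw [psi_eq_iff_coeffMatrix hM] at hx hy
  refine Subtype.ext (eq_of_mulVec_rep_eq_zero ?_ hy hx)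
  rw [Fintype.card_fin, ha]

end DegLocus

end

/-! ### The main theorem: numerical criteria from the rank statements. -/

open DegLocus

theorem mainTheorem4 (n m s : ℕ) (hn : 3 ≤ n) (hs₁ : m + 2 ≤ s) (hs₂ : s ≤ 2 * m + 3) :
    DegLocus.ForGeneral fun M : DegLocus.LinMatrix n m s =>
      -- `f` and `ψ` are well defined, and `ψ` is a morphism
      ∃ hf : Function.Injective (DegLocus.coeffMatrix M),
      (∀ (x : DegLocus.locus M) (α : ℙ ℂ (Fin n → ℂ)),
        DegLocus.psi M x = α ↔ (DegLocus.evalAt M x.1.rep).transpose.mulVec α.rep = 0) ∧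
      DegLocus.IsMorphism (DegLocus.locus M) (DegLocus.psi M) ∧
      -- (i)
      (s = n + m →
        (Function.Surjective (DegLocus.psi M) ∧
          ∃ W : Set (ℙ ℂ (Fin n → ℂ)), IsOpen W ∧ W.Nonempty ∧
            ∀ α ∈ W, ∃! x : DegLocus.locus M, DegLocus.psi M x = α) ∧
        ((∃ y, DegLocus.fibreDim M hf y = 1) ∧
          {y | 1 ≤ DegLocus.fibreDim M hf y} =
            Set.range (DegLocus.embed M hf) ∩ DegLocus.rankStratum (n + m) (s + 1) (s - 1) ∧
          {y | DegLocus.fibreDim M hf y = 1} =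
            Set.range (DegLocus.embed M hf) ∩ (DegLocus.rankStratum (n + m) (s + 1) (s - 1) \
              DegLocus.rankStratum (n + m) (s + 1) (s - 2)))) ∧
      -- (ii)
      (s < n + m →
        ((DegLocus.IsClosedImmersion (DegLocus.locus M) (DegLocus.psi M) ↔
            (n : ℤ) > 2 * s - 2 * m - 3) ∧
          ((n : ℤ) > 2 * s - 2 * m - 3 →
            Set.range (DegLocus.fpsi M hf) =
              Set.range (DegLocus.embed M hf) ∩ DegLocus.rankStratum (n + m) (s + 1) s)) ∧
        (((∃ y, DegLocus.fibreDim M hf y = 1) ↔ (n : ℤ) ≤ 2 * s - 2 * m - 3) ∧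
          {y | 1 ≤ DegLocus.fibreDim M hf y} =
            Set.range (DegLocus.embed M hf) ∩ DegLocus.rankStratum (n + m) (s + 1) (s - 1) ∧
          {y | DegLocus.fibreDim M hf y = 1} =
            Set.range (DegLocus.embed M hf) ∩ (DegLocus.rankStratum (n + m) (s + 1) (s - 1) \
              DegLocus.rankStratum (n + m) (s + 1) (s - 2))) ∧
        (((∃ y, DegLocus.fibreDim M hf y = 2) ↔ (n : ℚ) ≤ 1 / 2 * (3 * s - 3 * m - 7)) ∧
          {y | 2 ≤ DegLocus.fibreDim M hf y} =
            Set.range (DegLocus.embed M hf) ∩ DegLocus.rankStratum (n + m) (s + 1) (s - 2) ∧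
          {y | DegLocus.fibreDim M hf y = 2} =
            Set.range (DegLocus.embed M hf) ∩ (DegLocus.rankStratum (n + m) (s + 1) (s - 2) \
              DegLocus.rankStratum (n + m) (s + 1) (s - 3)))) := by
  have hA := forGeneral_le_rank_evalAt (n := n) (m := m) (s := s) (by omega) hs₂
  -- Rank greater than `0` for all nonzero `α` is the injectivity of `α ↦ A_α`.
  have hB := forGeneral_lt_rank_coeffMatrix (n := n) (m := m) (s := s) (k := 0) (by omega)
    (by omega) (by simp only [Nat.sub_zero]; nlinarith)
  -- The number `2(n + m - s + 1)` is the codimension of rank at most `s - 1`, and `3(n + m - s +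
  -- 2)` below is that of rank at most `s - 2`.
  have hC := ForGeneral.imp (p := s ≤ n + m ∧ 2 * (n + m - s + 1) < n) fun h =>
    forGeneral_exists_rank_coeffMatrix_eq (n := n) (m := m) (s := s) (k := s - 1) (by omega)
      (by omega) (by omega) (by
        rw [show n + m - (s - 1) = n + m - s + 1 by omega, show s + 1 - (s - 1) = 2 by omega]
        omega)
  have hD := ForGeneral.imp (p := s < n + m ∧ n ≤ 2 * (n + m - s + 1)) fun h =>
    forGeneral_lt_rank_coeffMatrix (n := n) (m := m) (s := s) (k := s - 1) (by omega) (by omega) (by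
      rw [show n + m - (s - 1) = n + m - s + 1 by omega, show s + 1 - (s - 1) = 2 by omega]
      omega)
  have hE := ForGeneral.imp (p := s < n + m ∧ 3 * (n + m - s + 2) < n) fun h =>
    forGeneral_exists_rank_coeffMatrix_eq (n := n) (m := m) (s := s) (k := s - 2) (by omega)
      (by omega) (by omega) (by
        rw [show n + m - (s - 2) = n + m - s + 2 by omega, show s + 1 - (s - 2) = 3 by omega]
        omega)
  have hF := ForGeneral.imp (p := s < n + m ∧ n ≤ 3 * (n + m - s + 2)) fun h =>
    forGeneral_lt_rank_coeffMatrix (n := n) (m := m) (s := s) (k := s - 2) (by omega) (by omega) (by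
      rw [show n + m - (s - 2) = n + m - s + 2 by omega, show s + 1 - (s - 2) = 3 by omega]
      omega)
  have hG := ForGeneral.imp (p := s = n + m) fun h =>
    forGeneral_exists_rank_coeffMatrix_eq (n := n) (m := m) (s := s) (k := s) (by omega)
      (by omega) (by omega) (by
        rw [show n + m - s = 0 by omega]
        omega)
  refine (hA.and (hB.and (hC.and (hD.and (hE.and (hF.and hG)))))).mono ?_
  rintro M ⟨hM, hB, hC, hD, hE, hF, hG⟩
  have hf := injective_coeffMatrix hB
  have le_one := fun y => natCast_le_fibreDim_iff hM hf (d := 1) (by omega) y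
  have eq_one := fun y => fibreDim_eq_natCast_iff hM hf (d := 1) (by omega) y
  have le_two := fun y => natCast_le_fibreDim_iff hM hf (d := 2) (by omega) y
  have eq_two := fun y => fibreDim_eq_natCast_iff hM hf (d := 2) (by omega) y
  rw [Nat.cast_one] at le_one eq_one
  rw [Nat.cast_ofNat] at le_two eq_two
  have exists_one : s ≤ n + m → 2 * (n + m - s + 1) < n → ∃ y, fibreDim M hf y = 1 := by
    intro h h'
    obtain ⟨a, ha⟩ := hC ⟨h, h'⟩
    exact ⟨embed M hf a, by simpa using fibreDim_embed hM hf a (d := 1) (by omega)⟩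
  refine ⟨hf, psi_eq_iff hM, (isLocallyPolynomial_psi hM).isMorphism, fun hs => ?_, fun hs => ?_⟩
  -- When `s = n + m`, the matrices `A_α` have `s` rows, so their rank never exceeds `s`. The open
  -- set is the locus of maximal rank, and the codimension for rank `s - 1` is `2 < n`.
  · refine ⟨⟨surjective_psi hM hs.ge, _, isOpen_le_rank_contract M s, ?_, fun a ha => ?_⟩,
      exists_one hs.le (by omega), Set.ext le_one, Set.ext eq_one⟩
    · obtain ⟨a, ha⟩ := hG hs
      exact ⟨a, ha.ge⟩
    · exact existsUnique_psi_eq hM (le_antisymm ((Matrix.rank_le_height _).trans hs.ge) ha)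
  · refine ⟨⟨⟨fun h => ?_, fun h => ?_⟩, fun _ => range_fpsi hM hf⟩,
      ⟨⟨?_, fun h => exists_one hs.le (by omega)⟩, Set.ext le_one, Set.ext eq_one⟩,
      ⟨⟨?_, fun h => ?_⟩, Set.ext le_two, Set.ext eq_two⟩⟩
    · by_contra hn'
      obtain ⟨a, ha⟩ := hC ⟨hs.le, by omega⟩
      exact not_injective_psi_of_rank_lt hM (a := a) (by omega) h.isClosedEmbedding.injective
    · refine isClosedImmersion_psi hM fun a ha => ?_
      have := hD ⟨hs, by omega⟩ a ha
      omega
    · rintro ⟨y, hy⟩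
      by_contra hn'
      obtain ⟨⟨a, rfl⟩, ha, -⟩ := (eq_one y).mp hy
      have h1 := hD ⟨hs, by omega⟩ _ a.rep_nonzero
      change (embed M hf a).rep.rank ≤ s - 1 at ha
      rw [rank_rep_embed] at ha
      omega
    · rintro ⟨y, hy⟩
      by_contra hn'
      obtain ⟨⟨a, rfl⟩, ha, -⟩ := (eq_two y).mp hy
      have h1 := hF ⟨hs, by
        by_contra h2
        apply hn'
        -- Over the integers, `3(n + m - s + 2) < n` is the rational bound on `n` with its
        -- denominator cleared.
        have h3 : 2 * n + 3 * m + 7 ≤ 3 * s := by omega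
        have h4 : (2 * n + 3 * m + 7 : ℚ) ≤ 3 * s := by exact_mod_cast h3
        linarith⟩ _ a.rep_nonzero
      change (embed M hf a).rep.rank ≤ s - 2 at ha
      rw [rank_rep_embed] at ha
      omega
    · have h3 : 2 * n + 3 * m + 7 ≤ 3 * s := by
        have h4 : (2 * n + 3 * m + 7 : ℚ) ≤ 3 * s := by linarith
        exact_mod_cast h4
      obtain ⟨a, ha⟩ := hE ⟨hs, by omega⟩
      exact ⟨embed M hf a, by simpa using fibreDim_embed hM hf a (d := 2) (by omega)⟩
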